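/- **Setting.** For $N\ge 1$ let $\mathcal D_N$ be the set of dimer configurations (sets of pairwise non-incident edges) of the complete graph $K_N$ with vertex set $V_N$ and edge set $E_N$. For $D\in\mathcal D_N$ let $\alpha_v(D)=1$ if the vertex $v$ is a monomer (is covered by no edge of $D$) and $\alpha_v(D)=0$ otherwise, let $\alpha_e(D)=1$ if $e\in D$ and $0$ otherwise, and let $m_N(D)=\frac1N\sum_{v}\alpha_v(D)$ be the fraction of monomers. For $J\ge 0$ and $h\in\mathbb R$ let $\langle\cdot\rangle$ denote the expectation with respect to the Gibbs probability measure on $\mathcal D_N$ proportional to $e^{-H_N}$, where $$H_N=-\sum_{v\in V_N}h\,\alpha_v+\log N\sum_{e\in E_N}\alpha_e-\sum_{uv\in E_N}\frac JN\bigl(\alpha_u\alpha_v+(1-\alpha_u)(1-\alpha_v)\bigr),$$ and write $\langle m_N(J,h)\rangle$ for the expectation of $m_N$. Put $$g(\xi)=\tfrac12\Bigl(\sqrt{e^{4\xi}+4e^{2\xi}}-e^{2\xi}\Bigr),\qquad p^{\mathrm{md}}(\xi)=-\frac{1-g(\xi)}2-\frac12\log(1-g(\xi)),$$ $$\tilde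 p(m,J,h)=-Jm^2+\tfrac12J+p^{\mathrm{md}}((2m-1)J+h).$$ An *equilibrium value* at $(J,h)$ is a number $m\in[0,1]$ which solves the consistency equation $m=g((2m-1)J+h)$ and maximizes $\tilde p(\cdot,J,h)$ on $[0,1]$. The *coexistence curve* $\Gamma$ is the set of all $(J,h)$ with $J\ge0$ that have two distinct equilibrium values; the *critical point*, its end point, is $(J_c,h_c)=\bigl(\frac1{4(3-2\sqrt2)},\ \frac12\ln(2\sqrt2-2)-\frac14\bigr)$. Let $m(J,h)$ denote the equilibrium value (on $\Gamma$, where it is not unique, the largest one, by convention). **Theorem.** Let $J\ge0$ and $h\in\mathbb R$ with $(J,h)\notin\Gamma$ and $(J,h)\ne(J_c,h_c)$. Then $m(J,h)$ is an equilibrium value and $\lim_{N\to\infty}\langle m_N(J,h)\rangle=m(J,h)$. The function $h'\mapsto\langle m_N(J,h')\rangle$ is differentiable at $h$ for every $N\ge1$, with derivative the finite-size susceptibility $N\bigl(\langle m_N^2\rangle-\langle m_N\rangle^2\bigr)$, the function $h'\mapsto m(J,h')$ is differentiable at $h$, and $$\lim_{N\to\infty}\frac{\partial}{\partial h}\langle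 m_N(J,h)\rangle=\frac{\partial}{\partial h}m(J,h).$$ Moreover, with $g'$ evaluated at $(2m(J,h)-1)J+h$, one has $1-2Jg'>0$ and the common value is $$\frac{\partial}{\partial h}m(J,h)=\frac{g'}{1-2Jg'}.$$ -/

import Mathlib

open Filter Topology

noncomputable section

namespace MonomerDimer

/-! ### Dimer configurations on a finite graph -/

/-- A dimer configuration on `G`: a finite set of edges of `G`, no two of which share a vertex. -/
def IsDimerConfig {V : Type*} (G : SimpleGraph V) (D : Finset (Sym2 V)) : Prop :=
  (∀ e ∈ D, e ∈ G.edgeSet) ∧ ∀ e ∈ D, ∀ f ∈ D, e ≠ f → ∀ v : V, ¬ (v ∈ e ∧ v ∈ f)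

open Classical in
/-- The set of all dimer configurations on the complete graph with vertex set `Fin N`. -/
def dimerConfigs (N : ℕ) : Finset (Finset (Sym2 (Fin N))) :=
  Finset.univ.filter (fun D => IsDimerConfig (⊤ : SimpleGraph (Fin N)) D)

open Classical in
/-- The monomers of `D`: the vertices that are covered by no edge of `D`. -/
def monomers {N : ℕ} (D : Finset (Sym2 (Fin N))) : Finset (Fin N) :=
  Finset.univ.filter (fun v => ∀ e ∈ D, v ∉ e)

/-- The monomer indicator of a vertex. -/
def alphaV {N : ℕ} (D : Finset (Sym2 (Fin N))) (v : Fin N) : ℝ :=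
  if v ∈ monomers D then 1 else 0

/-- The dimer indicator of an edge. -/
def alphaE {N : ℕ} (D : Finset (Sym2 (Fin N))) (e : Sym2 (Fin N)) : ℝ :=
  if e ∈ D then 1 else 0

/-- The edges of the complete graph, listed as ordered pairs `u < v`. -/
def edgePairs (N : ℕ) : Finset (Fin N × Fin N) :=
  Finset.univ.filter (fun p => p.1 < p.2)

/-! ### The imitative monomer-dimer model on the complete graph -/

/-- The Hamiltonian of the imitative monomer-dimer model on the complete graph. -/
def hamiltonian (N : ℕ) (J h : ℝ) (D : Finset (Sym2 (Fin N))) : ℝ :=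
  -(∑ v : Fin N, h * alphaV D v)
    + Real.log N * ∑ p ∈ edgePairs N, alphaE D s(p.1, p.2)
    - ∑ p ∈ edgePairs N, J / N *
        (alphaV D p.1 * alphaV D p.2 + (1 - alphaV D p.1) * (1 - alphaV D p.2))

/-- The partition function. -/
def partitionFunction (N : ℕ) (J h : ℝ) : ℝ :=
  ∑ D ∈ dimerConfigs N, Real.exp (-hamiltonian N J h D)

/-- The Gibbs probability of a dimer configuration. -/
def gibbsWeight (N : ℕ) (J h : ℝ) (D : Finset (Sym2 (Fin N))) : ℝ :=
  Real.exp (-hamiltonian N J h D) / partitionFunction N J h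

/-- The expectation of an observable under the Gibbs measure. -/
def gibbsMean (N : ℕ) (J h : ℝ) (f : Finset (Sym2 (Fin N)) → ℝ) : ℝ :=
  ∑ D ∈ dimerConfigs N, f D * gibbsWeight N J h D

/-- The fraction of vertices that are monomers of `D`. -/
def monomerFraction {N : ℕ} (D : Finset (Sym2 (Fin N))) : ℝ :=
  ((monomers D).card : ℝ) / N

/-- The finite-size monomer density `⟨m_N(J,h)⟩`. -/
def meanDensity (N : ℕ) (J h : ℝ) : ℝ :=
  gibbsMean N J h monomerFraction

/-- The finite-size susceptibility `N (⟨m_N²⟩ - ⟨m_N⟩²)`. -/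
def susceptibility (N : ℕ) (J h : ℝ) : ℝ :=
  N * (gibbsMean N J h (fun D => monomerFraction D ^ 2) - meanDensity N J h ^ 2)

/-! ### The thermodynamic limit -/

/-- The function `g`. -/
def g (ξ : ℝ) : ℝ :=
  (Real.sqrt (Real.exp (4 * ξ) + 4 * Real.exp (2 * ξ)) - Real.exp (2 * ξ)) / 2

/-- The limiting pressure of the pure monomer-dimer model. -/
def pMD (ξ : ℝ) : ℝ :=
  -(1 - g ξ) / 2 - Real.log (1 - g ξ) / 2

/-- The variational pressure. -/
def pTilde (J h m : ℝ) : ℝ :=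
  -J * m ^ 2 + J / 2 + pMD ((2 * m - 1) * J + h)

/-- An equilibrium value of the monomer density: a solution of the consistency equation which
maximizes the variational pressure. (For `J > 0` a maximizer solves the consistency equation
automatically; for `J = 0` the variational pressure does not depend on `m`.) -/
def IsEquilibrium (J h m : ℝ) : Prop :=
  m ∈ Set.Icc (0 : ℝ) 1 ∧ m = g ((2 * m - 1) * J + h) ∧
    IsMaxOn (pTilde J h) (Set.Icc (0 : ℝ) 1) m

/-- The limiting monomer density `m(J,h)`. Off the coexistence curve there is exactly one
equilibrium value, and this is it; on the curve, where two of them coexist, taking the largest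
one is a mere convention. -/
def limitDensity (J h : ℝ) : ℝ :=
  sSup {m : ℝ | IsEquilibrium J h m}

/-- The coexistence curve: the parameters with two distinct equilibrium values. Its end point,
the critical point, is not included. -/
def coexistenceCurve : Set (ℝ × ℝ) :=
  {p | 0 ≤ p.1 ∧ ∃ m₁ m₂ : ℝ, m₁ ≠ m₂ ∧ IsEquilibrium p.1 p.2 m₁ ∧ IsEquilibrium p.1 p.2 m₂}

/-- The critical point `(J_c, h_c)`. -/
def criticalPoint : ℝ × ℝ :=
  (1 / (4 * (3 - 2 * Real.sqrt 2)), Real.log (2 * Real.sqrt 2 - 2) / 2 - 1 / 4)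

end MonomerDimer

end

/-!
Grouping the dimer configurations by their number `k` of dimers turns the Gibbs measure into an
explicit law on the densities `m = (N - 2 k) / N`, because there are `N! / (k! (N - 2 k)! 2 ^ k)`
configurations with `k` dimers (`card_dimerConfigsCard`, by double counting) and the Hamiltonian
depends on `k` only. By Stirling's formula the weight of `m` is `exp (N * rate J h m)` up to a
polynomial factor.

*Limit.* Completing the square in the interaction reduces the comparison of `pTilde` with `rate` to
the Legendre inequality `entropy m + ξ m ≤ pMD ξ`, whose defect is a sum of two relative entropies.
Hence the equilibrium values are exactly the maximizers of `rate` on `[0, 1]`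
(`isEquilibrium_iff`), and when the maximizer `M` is unique the density concentrates exponentially
at `M` (`tendsto_mul_densityMean_farFrom`). Uniqueness forces the maximum to be nondegenerate except
at the critical point (`deriv2_rate_neg`): if the second derivative vanishes but the third does not,
`rate` is monotone near `M`. Since `chemPot` is the inverse of `g`, the limiting density is a
continuous local inverse of `m ↦ chemPot m - (2 m - 1) J`, and thus differentiable in `h`.

*Fluctuations.* Creation and annihilation of a dimer are in detailed balance, which is Stein's
identity (`densityMean_stein`) for the law of `m`. It says that
`N E[φ(m) F(m)] = 2 E[φ'(m) (1 - m)] + O(E|φ|)` with `F = drift J h`, a function that has a simple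
zero at `M`. The choice `φ = m - M` gives `N E[(m - M)²] → 2 (1 - M) / F'(M)`, and `φ = 1` shows
that `N (E[m] - M)² → 0` (`tendsto_variance`). So the susceptibility converges to
`2 (1 - M) / F'(M)`, which is the derivative of the limiting density.
-/
open Filter Topology

noncomputable section

namespace MonomerDimer

/-! ### The function `g` and its inverse -/

lemma g_sq (ξ : ℝ) : g ξ ^ 2 = Real.exp (2 * ξ) * (1 - g ξ) := by
  have h4 : Real.exp (4 * ξ) = Real.exp (2 * ξ) ^ 2 := by
    rw [← Real.exp_nat_mul]; congr 1; push_cast; ring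
  have hS : Real.sqrt (Real.exp (4 * ξ) + 4 * Real.exp (2 * ξ)) ^ 2
      = Real.exp (2 * ξ) ^ 2 + 4 * Real.exp (2 * ξ) := by
    rw [Real.sq_sqrt (by positivity), h4]
  unfold g
  linear_combination hS / 4

lemma g_pos (ξ : ℝ) : 0 < g ξ := by
  have h4 : Real.exp (4 * ξ) = Real.exp (2 * ξ) ^ 2 := by
    rw [← Real.exp_nat_mul]; congr 1; push_cast; ring
  have : Real.exp (2 * ξ) < Real.sqrt (Real.exp (4 * ξ) + 4 * Real.exp (2 * ξ)) := by
    apply Real.lt_sqrt_of_sq_lt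
    rw [h4]
    have := Real.exp_pos (2 * ξ)
    linarith
  unfold g
  linarith

lemma g_lt_one (ξ : ℝ) : g ξ < 1 := by
  have h1 : 0 < Real.exp (2 * ξ) * (1 - g ξ) := by
    rw [← g_sq]; have := g_pos ξ; positivity
  have := pos_of_mul_pos_right h1 (Real.exp_pos _).le
  linarith

/-- The chemical potential at which the pure monomer-dimer model has monomer density `m`. -/
def chemPot (m : ℝ) : ℝ := Real.log m - Real.log (1 - m) / 2

lemma chemPot_g (ξ : ℝ) : chemPot (g ξ) = ξ := by
  have h := congrArg Real.log (g_sq ξ)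
  have h1 : (1 - g ξ) ≠ 0 := by have := g_lt_one ξ; linarith
  rw [Real.log_mul (Real.exp_pos _).ne' h1, Real.log_exp, Real.log_pow] at h
  unfold chemPot
  push_cast at h
  linarith

lemma hasDerivAt_chemPot {m : ℝ} (h0 : 0 < m) (h1 : m < 1) :
    HasDerivAt chemPot (1 / m + 1 / (2 * (1 - m))) m := by
  have e1 := Real.hasDerivAt_log h0.ne'
  have h1' : 1 - m ≠ 0 := by linarith
  have e2 := (((hasDerivAt_id m).const_sub 1).log h1').div_const 2
  refine (e1.sub e2).congr_deriv ?_
  simp only [id]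
  field_simp
  ring

lemma continuous_g : Continuous g := by unfold g; fun_prop

lemma hasDerivAt_g (ξ : ℝ) :
    HasDerivAt g (1 / g ξ + 1 / (2 * (1 - g ξ)))⁻¹ ξ := by
  have h0 := g_pos ξ
  have h1 : 0 < 1 - g ξ := by have := g_lt_one ξ; linarith
  refine HasDerivAt.of_local_left_inverse continuous_g.continuousAt
    (hasDerivAt_chemPot h0 (g_lt_one ξ)) (by positivity) ?_
  exact Eventually.of_forall chemPot_g

/-! ### The Gibbs variational principle -/

/-- The entropy per vertex of the dimer configurations with monomer density `m`. -/
def entropy (m : ℝ) : ℝ := -(1 - m) / 2 - (1 - m) * Real.log (1 - m) / 2 - m * Real.log m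

/-- The exponential rate, per vertex, of the total Gibbs weight of the dimer configurations with
monomer density `m`. -/
def rate (J h m : ℝ) : ℝ := entropy m + h * m + J * (m ^ 2 - m + 1 / 2)

lemma continuous_entropy : Continuous entropy := by
  have h1 : Continuous fun m : ℝ => (1 - m) * Real.log (1 - m) :=
    Real.continuous_mul_log.comp (continuous_const.sub continuous_id)
  have h2 := Real.continuous_mul_log
  unfold entropy
  fun_prop

lemma continuous_rate (J h : ℝ) : Continuous (rate J h) := by
  have := continuous_entropy
  unfold rate
  fun_prop

lemma mul_log_sub_log_eq {x y : ℝ} (hx : 0 ≤ x) (hy : 0 < y) :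
    x * (Real.log x - Real.log y) = x - y + y * InformationTheory.klFun (x / y) := by
  rcases hx.eq_or_lt with rfl | hx
  · simp [InformationTheory.klFun]
  · rw [InformationTheory.klFun, Real.log_div hx.ne' hy.ne']
    field_simp
    ring

/-- The defect in the Legendre inequality is a sum of two relative entropies. -/
lemma pMD_sub_eq {m : ℝ} (h0 : 0 ≤ m) (h1 : m ≤ 1) (ξ : ℝ) :
    pMD ξ - (entropy m + ξ * m) = g ξ * InformationTheory.klFun (m / g ξ)
      + (1 - g ξ) * InformationTheory.klFun ((1 - m) / (1 - g ξ)) / 2 := by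
  have e1 := mul_log_sub_log_eq h0 (g_pos ξ)
  have e2 := mul_log_sub_log_eq (sub_nonneg.2 h1) (sub_pos.2 (g_lt_one ξ))
  have e3 := chemPot_g ξ
  unfold chemPot at e3
  unfold pMD entropy
  linear_combination e1 + e2 / 2 + m * e3

lemma entropy_add_le_pMD {m : ℝ} (h0 : 0 ≤ m) (h1 : m ≤ 1) (ξ : ℝ) :
    entropy m + ξ * m ≤ pMD ξ := by
  have hg := g_pos ξ
  have hg1 := sub_pos.2 (g_lt_one ξ)
  have k1 := InformationTheory.klFun_nonneg (div_nonneg h0 hg.le)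
  have k2 := InformationTheory.klFun_nonneg (div_nonneg (sub_nonneg.2 h1) hg1.le)
  rw [← sub_nonneg, pMD_sub_eq h0 h1]
  positivity

lemma entropy_add_eq_pMD_iff {m : ℝ} (h0 : 0 ≤ m) (h1 : m ≤ 1) (ξ : ℝ) :
    entropy m + ξ * m = pMD ξ ↔ m = g ξ := by
  have hg := g_pos ξ
  have hg1 := sub_pos.2 (g_lt_one ξ)
  have k1 := InformationTheory.klFun_nonneg (div_nonneg h0 hg.le)
  have k2 := InformationTheory.klFun_nonneg (div_nonneg (sub_nonneg.2 h1) hg1.le)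
  have key := pMD_sub_eq h0 h1 ξ
  constructor
  · intro h
    rw [h, sub_self] at key
    have h3 : g ξ * InformationTheory.klFun (m / g ξ) = 0 := by
      have := mul_nonneg hg.le k1
      have := mul_nonneg hg1.le k2
      linarith
    have h4 := (mul_eq_zero.1 h3).resolve_left hg.ne'
    rw [InformationTheory.klFun_eq_zero_iff (div_nonneg h0 hg.le)] at h4
    exact (div_eq_one_iff_eq hg.ne').1 h4
  · rintro rfl
    rw [div_self hg.ne', div_self hg1.ne'] at key
    simp only [InformationTheory.klFun_one] at key
    linarith

/-- Completing the square in the interaction turns `rate` into the Legendre inequality. -/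
lemma pTilde_sub_rate (J h a m : ℝ) :
    pTilde J h a - (rate J h m - J * (m - a) ^ 2)
      = pMD ((2 * a - 1) * J + h) - (entropy m + ((2 * a - 1) * J + h) * m) := by
  unfold pTilde rate
  ring

/-- The equilibrium values are the most likely monomer densities. -/
theorem isEquilibrium_iff {J h : ℝ} (hJ : 0 ≤ J) (m : ℝ) :
    IsEquilibrium J h m ↔ m ∈ Set.Icc (0 : ℝ) 1 ∧ IsMaxOn (rate J h) (Set.Icc (0 : ℝ) 1) m := by
  have hgI : ∀ ξ, g ξ ∈ Set.Icc (0 : ℝ) 1 := fun ξ => ⟨(g_pos ξ).le, (g_lt_one ξ).le⟩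
  have hle : ∀ a, ∀ m ∈ Set.Icc (0 : ℝ) 1, rate J h m - J * (m - a) ^ 2 ≤ pTilde J h a := by
    intro a m hm
    have := pTilde_sub_rate J h a m
    have := entropy_add_le_pMD hm.1 hm.2 ((2 * a - 1) * J + h)
    linarith
  have heq : ∀ a, ∀ m ∈ Set.Icc (0 : ℝ) 1,
      (rate J h m - J * (m - a) ^ 2 = pTilde J h a ↔ m = g ((2 * a - 1) * J + h)) := by
    intro a m hm
    rw [← entropy_add_eq_pMD_iff hm.1 hm.2]
    have := pTilde_sub_rate J h a m
    constructor <;> intro h <;> linarith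
  have hself : ∀ m ∈ Set.Icc (0 : ℝ) 1, rate J h m ≤ pTilde J h m := by
    intro m hm
    simpa using hle m m hm
  constructor
  · rintro ⟨hm, hg, hmax⟩
    refine ⟨hm, fun x hx => ?_⟩
    have h1 := (heq m m hm).2 hg
    simp only [sub_self, ne_eq, OfNat.ofNat_ne_zero, not_false_eq_true, zero_pow, mul_zero,
      sub_zero] at h1
    rw [Set.mem_ofPred_eq, h1]
    exact (hself x hx).trans (hmax hx)
  · rintro ⟨hm, hmax⟩
    have hup : ∀ a, pTilde J h a + J * (g ((2 * a - 1) * J + h) - a) ^ 2 ≤ rate J h m := by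
      intro a
      have h1 := (heq a _ (hgI _)).2 rfl
      have h2 : rate J h (g ((2 * a - 1) * J + h)) ≤ rate J h m := hmax (hgI _)
      linarith
    have hup' : ∀ a, pTilde J h a ≤ rate J h m := by
      intro a
      have := hup a
      have : 0 ≤ J * (g ((2 * a - 1) * J + h) - a) ^ 2 := by positivity
      linarith
    refine ⟨hm, ?_, fun a _ => (hup' a).trans (hself m hm)⟩
    rw [← heq m m hm]
    simpa using le_antisymm (hself m hm) (hup' m)

lemma exists_isEquilibrium {J h : ℝ} (hJ : 0 ≤ J) : ∃ m, IsEquilibrium J h m := by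
  obtain ⟨m, hm, hmax⟩ := isCompact_Icc.exists_isMaxOn (Set.nonempty_Icc.2 (zero_le_one' ℝ))
    (continuous_rate J h).continuousOn
  exact ⟨m, (isEquilibrium_iff hJ m).2 ⟨hm, hmax⟩⟩

lemma isEquilibrium_limitDensity {J : ℝ} (hJ : 0 ≤ J) (h : ℝ) :
    IsEquilibrium J h (limitDensity J h) := by
  obtain ⟨m₀, hm₀⟩ := exists_isEquilibrium (h := h) hJ
  have hmax := (isEquilibrium_iff hJ _).1 hm₀
  have hset : {m | IsEquilibrium J h m}
      = Set.Icc (0 : ℝ) 1 ∩ rate J h ⁻¹' Set.Ici (rate J h m₀) := by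
    ext m
    rw [Set.mem_ofPred_eq, isEquilibrium_iff hJ]
    refine and_congr_right fun hm => ⟨fun h' => h' hmax.1, fun h' x hx => ?_⟩
    exact (show rate J h x ≤ rate J h m₀ from hmax.2 hx).trans h'
  have hc : IsCompact {m | IsEquilibrium J h m} := by
    rw [hset]
    exact isCompact_Icc.inter_right (isClosed_Ici.preimage (continuous_rate J h))
  exact hc.sSup_mem ⟨m₀, hm₀⟩

lemma IsEquilibrium.pos {J h m : ℝ} (hm : IsEquilibrium J h m) : 0 < m := by
  rw [hm.2.1]; exact g_pos _

lemma IsEquilibrium.lt_one {J h m : ℝ} (hm : IsEquilibrium J h m) : m < 1 := by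
  rw [hm.2.1]; exact g_lt_one _

lemma IsEquilibrium.chemPot_eq {J h m : ℝ} (hm : IsEquilibrium J h m) :
    chemPot m = (2 * m - 1) * J + h := by
  conv_lhs => rw [hm.2.1]
  exact chemPot_g _

lemma eq_limitDensity {J h : ℝ} (hJ : 0 ≤ J) (hcoex : (J, h) ∉ coexistenceCurve) {m : ℝ}
    (hm : IsEquilibrium J h m) : m = limitDensity J h := by
  by_contra hne
  exact hcoex ⟨hJ, m, _, hne, hm, isEquilibrium_limitDensity hJ h⟩

lemma rate_lt_of_ne {J h : ℝ} (hJ : 0 ≤ J) (hcoex : (J, h) ∉ coexistenceCurve) {m : ℝ}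
    (hm : m ∈ Set.Icc (0 : ℝ) 1) (hne : m ≠ limitDensity J h) :
    rate J h m < rate J h (limitDensity J h) := by
  have hmax := (isEquilibrium_iff hJ _).1 (isEquilibrium_limitDensity hJ h)
  by_contra! hle
  exact hne (eq_limitDensity hJ hcoex
    ((isEquilibrium_iff hJ m).2 ⟨hm, fun x hx => (hmax.2 hx).trans hle⟩))

/-- Away from the unique equilibrium value the rate function has a gap. -/
lemma exists_rate_gap {J h : ℝ} (hJ : 0 ≤ J) (hcoex : (J, h) ∉ coexistenceCurve) {ε : ℝ}
    (hε : 0 < ε) : ∃ δ > 0, ∀ m ∈ Set.Icc (0 : ℝ) 1, ε ≤ |m - limitDensity J h| →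
      rate J h m ≤ rate J h (limitDensity J h) - δ := by
  have hK : IsCompact (Set.Icc (0 : ℝ) 1 ∩ {m | ε ≤ |m - limitDensity J h|}) :=
    isCompact_Icc.inter_right (isClosed_le continuous_const (by fun_prop))
  rcases (Set.Icc (0 : ℝ) 1 ∩ {m | ε ≤ |m - limitDensity J h|}).eq_empty_or_nonempty with he | hne
  · exact ⟨1, one_pos, fun m hm hm' => (Set.eq_empty_iff_forall_notMem.1 he m ⟨hm, hm'⟩).elim⟩
  · obtain ⟨x, hx, hxm⟩ := hK.exists_isMaxOn hne (continuous_rate J h).continuousOn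
    have hxne : x ≠ limitDensity J h := by
      rintro rfl
      have := hx.2
      simp only [Set.mem_ofPred_eq, sub_self, abs_zero] at this
      linarith
    refine ⟨_, sub_pos.2 (rate_lt_of_ne hJ hcoex hx.1 hxne), fun m hm hm' => ?_⟩
    have : rate J h m ≤ rate J h x := hxm ⟨hm, hm'⟩
    linarith

/-! ### Nondegeneracy of the maximum -/

lemma hasDerivAt_rate (J h : ℝ) {m : ℝ} (h0 : 0 < m) (h1 : m < 1) :
    HasDerivAt (rate J h) ((2 * m - 1) * J + h - chemPot m) m := by
  have h1' : 1 - m ≠ 0 := by linarith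
  have hid := hasDerivAt_id m
  have e0 := (hid.const_sub 1)
  have e1 := Real.hasDerivAt_log h0.ne'
  have e2 := e0.log h1'
  have e3 := (((e0.neg.div_const 2).sub ((e0.mul e2).div_const 2)).sub (hid.mul e1)).add
    ((hid.const_mul h).add ((((hid.pow 2).sub hid).add_const (1 / 2)).const_mul J))
  refine (e3.congr_deriv ?_).congr_of_eventuallyEq (Eventually.of_forall fun x => ?_)
  · simp only [id, chemPot]
    field_simp
    ring
  · simp [rate, entropy]
    ring

lemma hasDerivAt_deriv_rate (J h : ℝ) {m : ℝ} (h0 : 0 < m) (h1 : m < 1) :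
    HasDerivAt (fun m => (2 * m - 1) * J + h - chemPot m)
      (2 * J - (1 / m + 1 / (2 * (1 - m)))) m := by
  have hid := hasDerivAt_id m
  have e := ((((hid.const_mul 2).sub_const 1).mul_const J).add_const h).sub
    (hasDerivAt_chemPot h0 h1)
  exact e.congr_deriv (by ring)

lemma hasDerivAt_deriv2_rate (J : ℝ) {m : ℝ} (h0 : 0 < m) (h1 : m < 1) :
    HasDerivAt (fun m => 2 * J - (1 / m + 1 / (2 * (1 - m))))
      (1 / m ^ 2 - 1 / (2 * (1 - m) ^ 2)) m := by
  have h1' : 1 - m ≠ 0 := by linarith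
  have hid := hasDerivAt_id m
  have e1 := hasDerivAt_inv h0.ne'
  have e2 := ((hid.const_sub 1).const_mul 2).inv (by simpa using h1')
  have e := (e1.add e2).const_sub (2 * J)
  refine (e.congr_deriv ?_).congr_of_eventuallyEq (Eventually.of_forall fun x => ?_)
  · simp only [id]
    field_simp
    ring
  · simp [one_div]

lemma eventually_nhdsGT_le_of_deriv_nonneg {f f' : ℝ → ℝ} {a : ℝ}
    (hf : ∀ᶠ x in 𝓝 a, HasDerivAt f (f' x) x) (hf' : ∀ᶠ x in 𝓝[>] a, 0 ≤ f' x) :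
    ∀ᶠ x in 𝓝[>] a, f a ≤ f x := by
  obtain ⟨r, hr, hball⟩ := Metric.eventually_nhds_iff.1 hf
  obtain ⟨u, hu, hIoo⟩ := (mem_nhdsGT_iff_exists_Ioo_subset).1 hf'
  have hmem : Set.Ioo a (min u (a + r)) ∈ 𝓝[>] a :=
    Ioo_mem_nhdsGT (lt_min hu (by linarith))
  filter_upwards [hmem] with x hx
  have hxu := hx.2.trans_le (min_le_left _ _)
  have hxr := hx.2.trans_le (min_le_right _ _)
  have hd : ∀ y ∈ Set.Icc a x, HasDerivAt f (f' y) y := fun y hy => hball (by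
    rw [Real.dist_eq, abs_lt]; constructor <;> linarith [hy.1, hy.2])
  obtain ⟨c, hc, hcs⟩ := exists_hasDerivAt_eq_slope f f' hx.1
    (fun y hy => (hd y hy).continuousAt.continuousWithinAt)
    (fun y hy => hd y (Set.Ioo_subset_Icc_self hy))
  have h0 : 0 ≤ f' c := hIoo ⟨hc.1, hc.2.trans hxu⟩
  rw [hcs, le_div_iff₀ (sub_pos.2 hx.1)] at h0
  linarith

lemma eventually_nhdsLT_le_of_deriv_nonneg {f f' : ℝ → ℝ} {a : ℝ}
    (hf : ∀ᶠ x in 𝓝 a, HasDerivAt f (f' x) x) (hf' : ∀ᶠ x in 𝓝[<] a, 0 ≤ f' x) :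
    ∀ᶠ x in 𝓝[<] a, f x ≤ f a := by
  obtain ⟨r, hr, hball⟩ := Metric.eventually_nhds_iff.1 hf
  obtain ⟨u, hu, hIoo⟩ := (mem_nhdsLT_iff_exists_Ioo_subset).1 hf'
  have hmem : Set.Ioo (max u (a - r)) a ∈ 𝓝[<] a :=
    Ioo_mem_nhdsLT (max_lt hu (by linarith))
  filter_upwards [hmem] with x hx
  have hxu := (le_max_left _ _).trans_lt hx.1
  have hxr := (le_max_right _ _).trans_lt hx.1
  have hd : ∀ y ∈ Set.Icc x a, HasDerivAt f (f' y) y := fun y hy => hball (by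
    rw [Real.dist_eq, abs_lt]; constructor <;> linarith [hy.1, hy.2])
  obtain ⟨c, hc, hcs⟩ := exists_hasDerivAt_eq_slope f f' hx.2
    (fun y hy => (hd y hy).continuousAt.continuousWithinAt)
    (fun y hy => hd y (Set.Ioo_subset_Icc_self hy))
  have h0 : 0 ≤ f' c := hIoo ⟨hxu.trans hc.1, hc.2⟩
  rw [hcs, le_div_iff₀ (sub_pos.2 hx.2)] at h0
  linarith

lemma eventually_nhdsGT_le_of_hasDerivAt_pos {f : ℝ → ℝ} {a c : ℝ}
    (hf : HasDerivAt f c a) (hc : 0 < c) : ∀ᶠ x in 𝓝[>] a, f a ≤ f x := by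
  have h := (hasDerivAt_iff_tendsto_slope.1 hf).eventually_const_lt hc
  filter_upwards [h.filter_mono (nhdsWithin_mono a fun x hx => ne_of_gt hx),
    self_mem_nhdsWithin] with x hx hxa
  rw [slope_def_field] at hx
  have := (div_pos_iff_of_pos_right (sub_pos.2 hxa)).1 hx
  linarith

lemma eventually_nhdsLT_le_of_hasDerivAt_neg {f : ℝ → ℝ} {a c : ℝ}
    (hf : HasDerivAt f c a) (hc : c < 0) : ∀ᶠ x in 𝓝[<] a, f a ≤ f x := by
  have h := (hasDerivAt_iff_tendsto_slope.1 hf).eventually_lt_const hc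
  filter_upwards [h.filter_mono (nhdsWithin_mono a fun x hx => ne_of_lt hx),
    self_mem_nhdsWithin] with x hx hxa
  rw [slope_def_field] at hx
  by_contra! hlt
  have := div_pos_of_neg_of_neg (sub_neg.2 hlt) (sub_neg.2 hxa)
  linarith

/-- The second and third derivatives of the rate function vanish together at an equilibrium value
only at the critical point. -/
lemma eq_criticalPoint {J h m : ℝ} (hm : IsEquilibrium J h m)
    (h2 : 2 * J - (1 / m + 1 / (2 * (1 - m))) = 0)
    (h3 : 1 / m ^ 2 - 1 / (2 * (1 - m) ^ 2) = 0) : (J, h) = criticalPoint := by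
  have h0 := hm.pos
  have h1 := sub_pos.2 hm.lt_one
  set s := Real.sqrt 2 with hs
  have hs0 : 0 < s := by positivity
  have hs2 : s ^ 2 = 2 := Real.sq_sqrt (by norm_num)
  have hm1 : m = s * (1 - m) := by
    rw [sub_eq_zero, div_eq_div_iff (by positivity) (by positivity)] at h3
    refine (sq_eq_sq₀ h0.le (by positivity)).1 ?_
    rw [mul_pow, hs2]
    linarith
  have hmv : m = 2 - s := by
    have : (1 + s) * (m - (2 - s)) = 0 := by linear_combination hm1 + hs2
    have := (mul_eq_zero.1 this).resolve_left (by positivity)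
    linarith
  have hJ : J = (3 + 2 * s) / 4 := by
    rw [hmv] at h2 h0 h1
    have h1' : (1 - (2 - s)) ≠ 0 := h1.ne'
    have h0' : 2 - s ≠ 0 := h0.ne'
    field_simp at h2
    have h5 : (2 - s) * (1 - (2 - s)) * (J - (3 + 2 * s) / 4) = 0 := by
      linear_combination h2 / 4 + (2 * s - 3) / 4 * hs2
    rcases mul_eq_zero.1 h5 with h6 | h6
    · exact absurd h6 (mul_ne_zero h0' h1')
    · linarith
  have h3s : 0 < 3 - 2 * s := by nlinarith
  refine Prod.ext ?_ ?_
  · change J = 1 / (4 * (3 - 2 * s))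
    rw [hJ]
    field_simp
    linear_combination -4 * hs2
  · change h = Real.log (2 * s - 2) / 2 - 1 / 4
    have hc := hm.chemPot_eq
    unfold chemPot at hc
    have hlog : Real.log (2 * s - 2) = 2 * Real.log m - Real.log (1 - m) := by
      have : 2 * s - 2 = m ^ 2 / (1 - m) := by
        rw [eq_div_iff h1.ne', hmv]
        linear_combination hs2
      rw [this, Real.log_div (by positivity) h1.ne', Real.log_pow]
      push_cast
      ring
    have hJm : (2 * m - 1) * J = 1 / 4 := by
      rw [hmv, hJ]
      linear_combination -hs2
    rw [hlog]
    linarith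

/-- Off the coexistence curve and the critical point the maximum of the rate function is
nondegenerate: otherwise the rate function would be monotone on one side of its unique maximizer
in the wrong direction. -/
theorem deriv2_rate_neg {J h : ℝ} (hJ : 0 ≤ J) (hcoex : (J, h) ∉ coexistenceCurve)
    (hcrit : (J, h) ≠ criticalPoint) :
    2 * J - (1 / limitDensity J h + 1 / (2 * (1 - limitDensity J h))) < 0 := by
  have heq := isEquilibrium_limitDensity hJ h
  have hlt : ∀ x, 0 < x → x < 1 → x ≠ limitDensity J h →
      rate J h x < rate J h (limitDensity J h) := fun x hx0 hx1 hne =>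
    rate_lt_of_ne hJ hcoex ⟨hx0.le, hx1.le⟩ hne
  have h0 := heq.pos
  have h1 := heq.lt_one
  have hψ : (2 * limitDensity J h - 1) * J + h - chemPot (limitDensity J h) = 0 := by
    rw [heq.chemPot_eq]; ring
  have h3 := eq_criticalPoint heq
  generalize limitDensity J h = M at *
  have hev : ∀ᶠ x in 𝓝 M, 0 < x ∧ x < 1 := (eventually_gt_nhds h0).and (eventually_lt_nhds h1)
  have d0 : ∀ᶠ x in 𝓝 M, HasDerivAt (rate J h) ((2 * x - 1) * J + h - chemPot x) x :=
    hev.mono fun x hx => hasDerivAt_rate J h hx.1 hx.2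
  have d1 : ∀ᶠ x in 𝓝 M, HasDerivAt (fun m => (2 * m - 1) * J + h - chemPot m)
      (2 * J - (1 / x + 1 / (2 * (1 - x)))) x :=
    hev.mono fun x hx => hasDerivAt_deriv_rate J h hx.1 hx.2
  have d2 := hasDerivAt_deriv2_rate J h0 h1
  -- The derivative of the rate function cannot be nonnegative just to the right of `M`, ...
  have hright : ¬ ∀ᶠ x in 𝓝[>] M, 0 ≤ (2 * x - 1) * J + h - chemPot x := by
    intro hc
    obtain ⟨x, hx, hxM, hx01⟩ := ((eventually_nhdsGT_le_of_deriv_nonneg d0 hc).and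
      (eventually_mem_nhdsWithin.and (hev.filter_mono nhdsWithin_le_nhds))).exists
    exact (hlt x hx01.1 hx01.2 (ne_of_gt hxM)).not_ge hx
  -- ... nor nonpositive just to the left of it.
  have hleft : ¬ ∀ᶠ x in 𝓝[<] M, (2 * x - 1) * J + h - chemPot x ≤ 0 := by
    intro hc
    have := eventually_nhdsLT_le_of_deriv_nonneg (d0.mono fun x hx => hx.neg)
      (hc.mono fun x hx => neg_nonneg.2 hx)
    obtain ⟨x, hx, hxM, hx01⟩ := (this.and
      (eventually_mem_nhdsWithin.and (hev.filter_mono nhdsWithin_le_nhds))).exists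
    have hx' : rate J h M ≤ rate J h x := neg_le_neg_iff.1 hx
    exact (hlt x hx01.1 hx01.2 (ne_of_lt hxM)).not_ge hx'
  by_contra! hχ
  rcases hχ.eq_or_lt with hχ | hχ
  · rcases lt_trichotomy (1 / M ^ 2 - 1 / (2 * (1 - M) ^ 2)) 0 with hc | hc | hc
    · refine hleft ?_
      have := eventually_nhdsLT_le_of_deriv_nonneg d1
        ((eventually_nhdsLT_le_of_hasDerivAt_neg d2 hc).mono fun x hx => hχ.le.trans hx)
      exact this.mono fun x hx => hx.trans hψ.le
    · exact hcrit (h3 hχ.symm hc)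
    · refine hright ?_
      have := eventually_nhdsGT_le_of_deriv_nonneg d1
        ((eventually_nhdsGT_le_of_hasDerivAt_pos d2 hc).mono fun x hx => hχ.le.trans hx)
      exact this.mono fun x hx => hψ.ge.trans hx
  · refine hright ?_
    have := eventually_nhdsGT_le_of_hasDerivAt_pos d1.self_of_nhds hχ
    exact this.mono fun x hx => hψ.ge.trans hx

/-! ### Differentiability of the limiting density -/

lemma continuousAt_limitDensity {J h : ℝ} (hJ : 0 ≤ J) (hcoex : (J, h) ∉ coexistenceCurve) :
    ContinuousAt (limitDensity J) h := by
  refine Metric.continuousAt_iff.2 fun ε hε => ?_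
  obtain ⟨δ, hδ, hgap⟩ := exists_rate_gap hJ hcoex hε
  refine ⟨δ, hδ, fun {h'} hh' => ?_⟩
  rw [Real.dist_eq] at hh' ⊢
  by_contra! hge
  have hM := (isEquilibrium_iff hJ _).1 (isEquilibrium_limitDensity hJ h)
  have hM' := (isEquilibrium_iff hJ _).1 (isEquilibrium_limitDensity hJ h')
  have e1 := hgap _ hM'.1 hge
  have e2 : rate J h' (limitDensity J h) ≤ rate J h' (limitDensity J h') := hM'.2 hM.1
  have e3 : ∀ m, rate J h' m = rate J h m + (h' - h) * m := fun m => by unfold rate; ring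
  rw [e3, e3] at e2
  have e4 : (h' - h) * (limitDensity J h' - limitDensity J h) ≤ |h' - h| * 1 := by
    refine (le_abs_self _).trans ?_
    rw [abs_mul]
    refine mul_le_mul_of_nonneg_left ?_ (abs_nonneg _)
    rw [abs_le]
    constructor <;> linarith [hM.1.1, hM.1.2, hM'.1.1, hM'.1.2]
  linarith

/-- The limiting density is a local inverse of `m ↦ chemPot m - (2 * m - 1) * J`. -/
lemma hasDerivAt_limitDensity {J h : ℝ} (hJ : 0 ≤ J) (hcoex : (J, h) ∉ coexistenceCurve)
    (hcrit : (J, h) ≠ criticalPoint) :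
    HasDerivAt (limitDensity J)
      (1 / limitDensity J h + 1 / (2 * (1 - limitDensity J h)) - 2 * J)⁻¹ h := by
  have heq := isEquilibrium_limitDensity hJ h
  have hd := (hasDerivAt_deriv_rate J 0 heq.pos heq.lt_one).neg
  have hneg := deriv2_rate_neg hJ hcoex hcrit
  have := HasDerivAt.of_local_left_inverse (continuousAt_limitDensity hJ hcoex) hd (by linarith)
    (Eventually.of_forall fun h' => by
      have := (isEquilibrium_limitDensity hJ h').chemPot_eq
      simp only [Pi.neg_apply]
      rw [this]; ring)
  rwa [neg_sub] at this

lemma deriv_g_limitDensity {J : ℝ} (hJ : 0 ≤ J) (h : ℝ) :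
    deriv g ((2 * limitDensity J h - 1) * J + h)
      = (1 / limitDensity J h + 1 / (2 * (1 - limitDensity J h)))⁻¹ := by
  rw [(hasDerivAt_g _).deriv, ← (isEquilibrium_limitDensity hJ h).2.1]

/-! ### Counting dimer configurations -/

lemma mem_dimerConfigs {N : ℕ} {D : Finset (Sym2 (Fin N))} :
    D ∈ dimerConfigs N ↔ IsDimerConfig (⊤ : SimpleGraph (Fin N)) D := by
  simp [dimerConfigs]

lemma mem_monomers {N : ℕ} {D : Finset (Sym2 (Fin N))} {v : Fin N} :
    v ∈ monomers D ↔ ∀ e ∈ D, v ∉ e := by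
  simp [monomers]

lemma IsDimerConfig.mono {V : Type*} {G : SimpleGraph V} {D D' : Finset (Sym2 V)}
    (h : IsDimerConfig G D) (hs : D' ⊆ D) : IsDimerConfig G D' :=
  ⟨fun e he => h.1 e (hs he), fun e he f hf => h.2 e (hs he) f (hs hf)⟩

lemma card_monomers_add {N : ℕ} {D : Finset (Sym2 (Fin N))} (hD : D ∈ dimerConfigs N) :
    (monomers D).card + 2 * D.card = N := by
  classical
  rw [mem_dimerConfigs] at hD
  have hcompl : (monomers D)ᶜ = D.biUnion Sym2.toFinset := by
    ext v
    simp [mem_monomers]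
  have hcard : (D.biUnion Sym2.toFinset).card = 2 * D.card := by
    rw [Finset.card_biUnion, Finset.sum_const_nat (m := 2), mul_comm]
    · intro e he
      apply Sym2.card_toFinset_of_not_isDiag
      have := hD.1 e he
      simpa using this
    · intro e he f hf hne
      rw [Function.onFun, Finset.disjoint_left]
      intro v hv hv'
      exact hD.2 e he f hf hne v ⟨Sym2.mem_toFinset.1 hv, Sym2.mem_toFinset.1 hv'⟩
  have := Finset.card_add_card_compl (monomers D)
  rw [hcompl, hcard, Fintype.card_fin] at this
  exact this

/-- The possible edges of a dimer added to `D`: those joining two monomers. -/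
def monomerPairs {N : ℕ} (D : Finset (Sym2 (Fin N))) : Finset (Sym2 (Fin N)) :=
  (monomers D).offDiag.image (fun p => s(p.1, p.2))

lemma mem_monomerPairs {N : ℕ} {D : Finset (Sym2 (Fin N))} {u v : Fin N} :
    s(u, v) ∈ monomerPairs D ↔ u ∈ monomers D ∧ v ∈ monomers D ∧ u ≠ v := by
  simp only [monomerPairs, Finset.mem_image, Finset.mem_offDiag, Prod.exists, Sym2.eq_iff]
  constructor
  · rintro ⟨a, b, ⟨ha, hb, hab⟩, ⟨rfl, rfl⟩ | ⟨rfl, rfl⟩⟩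
    · exact ⟨ha, hb, hab⟩
    · exact ⟨hb, ha, hab.symm⟩
  · rintro ⟨hu, hv, huv⟩
    exact ⟨u, v, ⟨hu, hv, huv⟩, Or.inl ⟨rfl, rfl⟩⟩

lemma notMem_of_mem_monomerPairs {N : ℕ} {D : Finset (Sym2 (Fin N))} {e : Sym2 (Fin N)}
    (he : e ∈ monomerPairs D) : e ∉ D := by
  induction e using Sym2.ind with
  | _ u v =>
    intro heD
    exact mem_monomers.1 (mem_monomerPairs.1 he).1 _ heD (Sym2.mem_mk_left u v)

lemma isDimerConfig_insert {N : ℕ} {D : Finset (Sym2 (Fin N))} {e : Sym2 (Fin N)}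
    (he : e ∉ D) : IsDimerConfig ⊤ (insert e D) ↔ IsDimerConfig ⊤ D ∧ e ∈ monomerPairs D := by
  induction e using Sym2.ind with
  | _ u v =>
    rw [mem_monomerPairs]
    constructor
    · intro h
      refine ⟨h.mono (Finset.subset_insert _ _), ?_, ?_, ?_⟩
      · refine mem_monomers.2 fun f hf huf => ?_
        exact h.2 _ (Finset.mem_insert_self _ _) f (Finset.mem_insert_of_mem hf)
          (fun hh => he (hh ▸ hf)) u ⟨Sym2.mem_mk_left u v, huf⟩
      · refine mem_monomers.2 fun f hf hvf => ?_
        exact h.2 _ (Finset.mem_insert_self _ _) f (Finset.mem_insert_of_mem hf)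
          (fun hh => he (hh ▸ hf)) v ⟨Sym2.mem_mk_right u v, hvf⟩
      · simpa using h.1 _ (Finset.mem_insert_self _ _)
    · rintro ⟨h, hu, hv, huv⟩
      have hdis : ∀ f ∈ D, ∀ w : Fin N, ¬ (w ∈ s(u, v) ∧ w ∈ f) := by
        rintro f hf w ⟨hw, hwf⟩
        rcases Sym2.mem_iff.1 hw with rfl | rfl
        · exact mem_monomers.1 hu f hf hwf
        · exact mem_monomers.1 hv f hf hwf
      constructor
      · intro f hf
        rcases Finset.mem_insert.1 hf with rfl | hf
        · simpa using huv
        · exact h.1 f hf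
      · intro f hf f' hf' hne w hw
        rcases Finset.mem_insert.1 hf with rfl | hfD
        · rcases Finset.mem_insert.1 hf' with rfl | hfD'
          · exact hne rfl
          · exact hdis f' hfD' w hw
        · rcases Finset.mem_insert.1 hf' with rfl | hfD'
          · exact hdis f hfD w hw.symm
          · exact h.2 f hfD f' hfD' hne w hw

/-- The dimer configurations with exactly `k` dimers. -/
def dimerConfigsCard (N k : ℕ) : Finset (Finset (Sym2 (Fin N))) :=
  (dimerConfigs N).filter (fun D => D.card = k)

/-- Double counting of the pairs `D' ⊆ D` of dimer configurations with `k` and `k + 1` dimers. -/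
lemma card_dimerConfigsCard_succ (N k : ℕ) :
    (dimerConfigsCard N k).card * (N - 2 * k).choose 2
      = (dimerConfigsCard N (k + 1)).card * (k + 1) := by
  classical
  apply Finset.card_mul_eq_card_mul (fun D' D => D' ⊆ D)
  · intro D' hD'
    obtain ⟨hD', hk⟩ := Finset.mem_filter.1 hD'
    have hset : (dimerConfigsCard N (k + 1)).bipartiteAbove (fun D' D => D' ⊆ D) D'
        = (monomerPairs D').image (fun e => insert e D') := by
      ext D
      simp only [Finset.mem_bipartiteAbove, dimerConfigsCard, Finset.mem_filter, Finset.mem_image]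
      constructor
      · rintro ⟨⟨hD, hDk⟩, hsub⟩
        obtain ⟨e, he, rfl⟩ := Finset.exists_eq_insert_iff.2 ⟨hsub, by omega⟩
        exact ⟨e, ((isDimerConfig_insert he).1 (mem_dimerConfigs.1 hD)).2, rfl⟩
      · rintro ⟨e, he, rfl⟩
        have heD := notMem_of_mem_monomerPairs he
        refine ⟨⟨mem_dimerConfigs.2
          ((isDimerConfig_insert heD).2 ⟨mem_dimerConfigs.1 hD', he⟩), ?_⟩,
          Finset.subset_insert _ _⟩
        rw [Finset.card_insert_of_notMem heD, hk]
    rw [hset, Finset.card_image_of_injOn]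
    · have := card_monomers_add hD'
      have h2 : (monomerPairs D').card = (monomers D').card.choose 2 :=
        Sym2.card_image_offDiag (monomers D')
      rw [h2]
      congr 1
      omega
    · intro e he f hf hef
      have he' := notMem_of_mem_monomerPairs he
      have : e ∈ insert f D' := by
        rw [← show insert e D' = insert f D' from hef]; exact Finset.mem_insert_self _ _
      exact (Finset.mem_insert.1 this).resolve_right he'
  · intro D hD
    obtain ⟨hD, hk⟩ := Finset.mem_filter.1 hD
    have hset : (dimerConfigsCard N k).bipartiteBelow (fun D' D => D' ⊆ D) D
        = D.powersetCard k := by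
      ext D'
      simp only [Finset.mem_bipartiteBelow, dimerConfigsCard, Finset.mem_filter,
        Finset.mem_powersetCard]
      constructor
      · rintro ⟨⟨_, h1⟩, h2⟩
        exact ⟨h2, h1⟩
      · rintro ⟨h2, h1⟩
        exact ⟨⟨mem_dimerConfigs.2 ((mem_dimerConfigs.1 hD).mono h2), h1⟩, h2⟩
    rw [hset, Finset.card_powersetCard, hk, Nat.choose_succ_self_right]

/-- There are `N! / (k! (N - 2k)! 2 ^ k)` dimer configurations with `k` dimers. -/
theorem card_dimerConfigsCard (N k : ℕ) (hk : 2 * k ≤ N) :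
    (dimerConfigsCard N k).card * (k.factorial * (N - 2 * k).factorial * 2 ^ k)
      = N.factorial := by
  induction k with
  | zero =>
    have : dimerConfigsCard N 0 = {∅} := by
      ext D
      simp only [dimerConfigsCard, Finset.mem_filter, Finset.card_eq_zero, Finset.mem_singleton,
        and_iff_right_iff_imp]
      rintro rfl
      exact mem_dimerConfigs.2 ⟨by simp, by simp⟩
    simp [this]
  | succ k ih =>
    obtain ⟨r, rfl⟩ : ∃ r, N = r + 2 * (k + 1) := ⟨N - 2 * (k + 1), by omega⟩
    have hrec := card_dimerConfigsCard_succ (r + 2 * (k + 1)) k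
    have h2 : r + 2 * (k + 1) - 2 * k = r + 2 := by omega
    have h3 : r + 2 * (k + 1) - 2 * (k + 1) = r := by omega
    specialize ih (by omega)
    rw [h2] at hrec ih
    rw [h3, ← ih, Nat.factorial_succ k, pow_succ, Nat.factorial_succ (r + 1), Nat.factorial_succ r]
    have hch' : (r + 2).choose 2 * 2 = (r + 2) * (r + 1) := by
      rw [Nat.choose_two_right]
      exact Nat.div_mul_cancel (Nat.even_mul_pred_self _).two_dvd
    calc _ = ((dimerConfigsCard (r + 2 * (k + 1)) (k + 1)).card * (k + 1))
            * (k.factorial * r.factorial * 2 ^ k * 2) := by ring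
      _ = (dimerConfigsCard (r + 2 * (k + 1)) k).card * ((r + 2).choose 2 * 2)
            * (k.factorial * r.factorial * 2 ^ k) := by rw [← hrec]; ring
      _ = _ := by rw [hch']; ring

/-! ### The Gibbs measure as a law on the number of dimers -/

lemma two_mul_sum_edgePairs {N : ℕ} (a : Fin N → ℝ) :
    2 * ∑ p ∈ edgePairs N, a p.1 * a p.2 = (∑ v, a v) ^ 2 - ∑ v, a v ^ 2 := by
  have hswap : ∑ p : Fin N × Fin N, (if p.2 < p.1 then a p.1 * a p.2 else 0)
      = ∑ p : Fin N × Fin N, (if p.1 < p.2 then a p.1 * a p.2 else 0) := by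
    rw [← Equiv.sum_comp (Equiv.prodComm (Fin N) (Fin N))]
    simp [mul_comm]
  have hdiag : ∑ p : Fin N × Fin N, (if p.1 = p.2 then a p.1 * a p.2 else 0)
      = ∑ v, a v ^ 2 := by
    rw [Fintype.sum_prod_type]
    simp [sq]
  have hall : (∑ v, a v) ^ 2 = ∑ p : Fin N × Fin N, ((if p.1 < p.2 then a p.1 * a p.2 else 0)
      + (if p.2 < p.1 then a p.1 * a p.2 else 0) + (if p.1 = p.2 then a p.1 * a p.2 else 0)) := by
    rw [sq, Finset.sum_mul_sum, ← Finset.univ_product_univ, Finset.sum_product]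
    refine Finset.sum_congr rfl fun u _ => Finset.sum_congr rfl fun v _ => ?_
    rcases lt_trichotomy u v with h | h | h
    · simp [h, h.not_gt, h.ne]
    · simp [h]
    · simp [h, h.not_gt, h.ne']
  rw [hall, Finset.sum_add_distrib, Finset.sum_add_distrib, hswap, hdiag, edgePairs,
    Finset.sum_filter]
  ring

lemma sum_edgePairs_alphaE {N : ℕ} {D : Finset (Sym2 (Fin N))} (hD : D ∈ dimerConfigs N) :
    ∑ p ∈ edgePairs N, alphaE D s(p.1, p.2) = D.card := by
  simp only [alphaE]
  rw [Finset.sum_boole]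
  congr 1
  refine Finset.card_bij (fun p _ => s(p.1, p.2)) ?_ ?_ ?_
  · intro p hp
    exact (Finset.mem_filter.1 hp).2
  · rintro ⟨a, b⟩ hp ⟨c, d⟩ hq heq
    have h1 : a < b := by simpa [edgePairs] using (Finset.mem_filter.1 hp).1
    have h2 : c < d := by simpa [edgePairs] using (Finset.mem_filter.1 hq).1
    rcases Sym2.eq_iff.1 heq with ⟨rfl, rfl⟩ | ⟨rfl, rfl⟩
    · rfl
    · exact absurd h1 h2.not_gt
  · intro e he
    have hnd := (mem_dimerConfigs.1 hD).1 e he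
    induction e using Sym2.ind with
    | _ u v =>
      have huv : u ≠ v := by simpa using hnd
      rcases huv.lt_or_gt with h | h
      · exact ⟨(u, v), by simp [edgePairs, h, he], rfl⟩
      · exact ⟨(v, u), by simp [edgePairs, h, Sym2.eq_swap, he], Sym2.eq_swap⟩

/-- The monomer density of a dimer configuration with `k` dimers on `N` vertices. -/
def density (N k : ℕ) : ℝ := ((N : ℝ) - 2 * k) / N

lemma sum_alphaV {N : ℕ} {D : Finset (Sym2 (Fin N))} (hD : D ∈ dimerConfigs N) :
    ∑ v, alphaV D v = (N : ℝ) - 2 * D.card := by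
  simp only [alphaV]
  rw [Finset.sum_boole, Finset.filter_univ_mem]
  have := congrArg (Nat.cast (R := ℝ)) (card_monomers_add hD)
  push_cast at this
  linarith

lemma monomerFraction_eq {N : ℕ} {D : Finset (Sym2 (Fin N))} (hD : D ∈ dimerConfigs N) :
    monomerFraction D = density N D.card := by
  have := congrArg (Nat.cast (R := ℝ)) (card_monomers_add hD)
  push_cast at this
  unfold monomerFraction density
  congr 1
  linarith

lemma hamiltonian_eq {N : ℕ} (hN : N ≠ 0) (J h : ℝ) {D : Finset (Sym2 (Fin N))}
    (hD : D ∈ dimerConfigs N) :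
    hamiltonian N J h D = Real.log N * D.card - (N * (h * density N D.card
      + J * (density N D.card ^ 2 - density N D.card + 1 / 2)) - J / 2) := by
  have hN' : (N : ℝ) ≠ 0 := Nat.cast_ne_zero.2 hN
  have hs := sum_alphaV hD
  have h1 : ∑ v, alphaV D v ^ 2 = ∑ v, alphaV D v :=
    Finset.sum_congr rfl fun v _ => by unfold alphaV; split_ifs <;> norm_num
  have h2 : ∑ v, (1 - alphaV D v) ^ 2 = ∑ v, (1 - alphaV D v) :=
    Finset.sum_congr rfl fun v _ => by unfold alphaV; split_ifs <;> norm_num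
  have h3 : ∑ v, (1 - alphaV D v) = 2 * D.card := by
    rw [Finset.sum_sub_distrib, hs]; simp
  have e1 := two_mul_sum_edgePairs (alphaV D)
  have e2 := two_mul_sum_edgePairs (fun v => 1 - alphaV D v)
  rw [h1, hs] at e1
  rw [h2, h3] at e2
  unfold hamiltonian
  rw [← Finset.mul_sum, hs, sum_edgePairs_alphaE hD, ← Finset.mul_sum, Finset.sum_add_distrib]
  have hd : density N D.card * N = (N : ℝ) - 2 * D.card := by
    unfold density; field_simp
  have hk : (D.card : ℝ) = N * (1 - density N D.card) / 2 := by linarith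
  generalize density N D.card = m at *
  rw [hk] at e1 e2 ⊢
  have e1' : ∑ p ∈ edgePairs N, alphaV D p.1 * alphaV D p.2
      = ((N * m) ^ 2 - N * m) / 2 := by linarith
  have e2' : ∑ p ∈ edgePairs N, (1 - alphaV D p.1) * (1 - alphaV D p.2)
      = ((N * (1 - m)) ^ 2 - N * (1 - m)) / 2 := by linarith
  rw [e1', e2']
  field_simp
  ring

/-- The total Gibbs weight, before normalization, of the dimer configurations with `k` dimers. -/
def weight (N : ℕ) (J h : ℝ) (k : ℕ) : ℝ :=
  (N.factorial : ℝ) / (k.factorial * (N - 2 * k).factorial * 2 ^ k) / N ^ k *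
    Real.exp (N * (h * density N k + J * (density N k ^ 2 - density N k + 1 / 2)) - J / 2)

lemma weight_pos {N : ℕ} (hN : N ≠ 0) (J h : ℝ) (k : ℕ) : 0 < weight N J h k := by
  have : (0 : ℝ) < N := by positivity
  unfold weight
  positivity

lemma sum_dimerConfigs {N : ℕ} (hN : N ≠ 0) (J h : ℝ) (f : ℝ → ℝ) :
    ∑ D ∈ dimerConfigs N, f (monomerFraction D) * Real.exp (-hamiltonian N J h D)
      = ∑ k ∈ Finset.range (N / 2 + 1), f (density N k) * weight N J h k := by
  have hN' : (0 : ℝ) < N := by positivity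
  have hmaps : ∀ D ∈ dimerConfigs N, D.card ∈ Finset.range (N / 2 + 1) := by
    intro D hD
    have := card_monomers_add hD
    rw [Finset.mem_range]
    omega
  rw [← Finset.sum_fiberwise_of_maps_to hmaps]
  refine Finset.sum_congr rfl fun k hk => ?_
  have hk' : 2 * k ≤ N := by
    have := Finset.mem_range.1 hk
    omega
  have hterm : ∀ D ∈ (dimerConfigs N).filter (fun D => D.card = k),
      f (monomerFraction D) * Real.exp (-hamiltonian N J h D)
        = f (density N k) * (1 / N ^ k * Real.exp (N * (h * density N k
          + J * (density N k ^ 2 - density N k + 1 / 2)) - J / 2)) := by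
    intro D hD
    obtain ⟨hD', rfl⟩ := Finset.mem_filter.1 hD
    rw [monomerFraction_eq hD', hamiltonian_eq hN J h hD', neg_sub, Real.exp_sub,
      mul_comm (Real.log N), Real.exp_nat_mul, Real.exp_log hN']
    ring
  rw [Finset.sum_congr rfl hterm, Finset.sum_const, nsmul_eq_mul]
  have hcard : (((dimerConfigs N).filter (fun D => D.card = k)).card : ℝ)
      = N.factorial / (k.factorial * (N - 2 * k).factorial * 2 ^ k) := by
    rw [eq_div_iff (by positivity)]
    exact_mod_cast card_dimerConfigsCard N k hk'
  rw [hcard]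
  unfold weight
  ring

lemma gibbsMean_eq {N : ℕ} (hN : N ≠ 0) (J h : ℝ) (f : ℝ → ℝ) :
    gibbsMean N J h (fun D => f (monomerFraction D))
      = (∑ k ∈ Finset.range (N / 2 + 1), f (density N k) * weight N J h k)
        / ∑ k ∈ Finset.range (N / 2 + 1), weight N J h k := by
  have h1 := sum_dimerConfigs hN J h (fun _ => 1)
  simp only [one_mul] at h1
  unfold gibbsMean gibbsWeight partitionFunction
  rw [← h1, ← sum_dimerConfigs hN J h f, Finset.sum_div]
  exact Finset.sum_congr rfl fun D _ => by ring

/-! ### The derivative of the finite-size density -/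

lemma hasDerivAt_meanDensity {N : ℕ} (hN : N ≠ 0) (J h : ℝ) :
    HasDerivAt (fun h' => meanDensity N J h') (susceptibility N J h) h := by
  have hN' : (N : ℝ) ≠ 0 := Nat.cast_ne_zero.2 hN
  have hd : ∀ c : ℝ → ℝ, HasDerivAt
      (fun h' => ∑ k ∈ Finset.range (N / 2 + 1), c (density N k) * weight N J h' k)
      (N * ∑ k ∈ Finset.range (N / 2 + 1), c (density N k) * density N k * weight N J h k) h := by
    intro c
    rw [Finset.mul_sum]
    refine HasDerivAt.fun_sum fun k _ => ?_
    unfold weight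
    have e := ((((hasDerivAt_id h).mul_const (density N k)).add_const
      (J * (density N k ^ 2 - density N k + 1 / 2))).const_mul (N : ℝ)).sub_const (J / 2)
    refine ((e.exp.const_mul _).const_mul (c (density N k))).congr_deriv ?_
    simp only [id]
    ring
  have hZ : 0 < ∑ k ∈ Finset.range (N / 2 + 1), weight N J h k :=
    Finset.sum_pos (fun k _ => weight_pos hN J h k) ⟨0, by simp⟩
  have h1 := hd (fun _ => 1)
  have hm := hd (fun m => m)
  simp only [one_mul] at h1
  have hfun : (fun h' => meanDensity N J h') = fun h' =>
      (∑ k ∈ Finset.range (N / 2 + 1), density N k * weight N J h' k)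
        / ∑ k ∈ Finset.range (N / 2 + 1), weight N J h' k :=
    funext fun h' => gibbsMean_eq hN J h' (fun m => m)
  rw [hfun]
  refine (hm.div h1 hZ.ne').congr_deriv ?_
  unfold susceptibility
  rw [gibbsMean_eq hN J h (fun m => m ^ 2), congrFun hfun h]
  simp only [← sq]
  field_simp

/-! ### The law of the monomer density -/

/-- Positivity on the range of summation, for `N = 0` as well. -/
lemma weight_pos_of_mem_range {N k : ℕ} (hk : k ∈ Finset.range (N / 2 + 1)) (J h : ℝ) :
    0 < weight N J h k := by
  have hk := Finset.mem_range.1 hk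
  rcases Nat.eq_zero_or_pos N with rfl | hN
  · obtain rfl : k = 0 := by omega
    unfold weight
    norm_num
    positivity
  · exact weight_pos hN.ne' J h k

/-- The sum of the weights: the partition function, reorganized by the number of dimers. -/
def totalWeight (N : ℕ) (J h : ℝ) : ℝ := ∑ k ∈ Finset.range (N / 2 + 1), weight N J h k

lemma totalWeight_pos (N : ℕ) (J h : ℝ) : 0 < totalWeight N J h :=
  Finset.sum_pos (fun _ hk => weight_pos_of_mem_range hk J h) ⟨0, by simp⟩

/-- The expectation of a function of the monomer density, as a linear functional. -/
def densityMean (J h : ℝ) (N : ℕ) : (ℝ → ℝ) →ₗ[ℝ] ℝ where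
  toFun f := ∑ k ∈ Finset.range (N / 2 + 1), f (density N k) * (weight N J h k / totalWeight N J h)
  map_add' f f' := by
    rw [← Finset.sum_add_distrib]
    exact Finset.sum_congr rfl fun k _ => by simp [add_mul]
  map_smul' c f := by
    rw [RingHom.id_apply, smul_eq_mul, Finset.mul_sum]
    exact Finset.sum_congr rfl fun k _ => by simp [mul_assoc]

lemma densityMean_apply (J h : ℝ) (N : ℕ) (f : ℝ → ℝ) : densityMean J h N f
    = (∑ k ∈ Finset.range (N / 2 + 1), f (density N k) * weight N J h k) / totalWeight N J h := by
  simp only [densityMean, LinearMap.coe_mk, AddHom.coe_mk, Finset.sum_div, mul_div_assoc]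

lemma gibbsMean_eq_densityMean {N : ℕ} (hN : N ≠ 0) (J h : ℝ) (f : ℝ → ℝ) :
    gibbsMean N J h (fun D => f (monomerFraction D)) = densityMean J h N f := by
  rw [gibbsMean_eq hN, densityMean_apply, totalWeight]

lemma density_mem_Icc {N k : ℕ} (hk : k ∈ Finset.range (N / 2 + 1)) :
    density N k ∈ Set.Icc (0 : ℝ) 1 := by
  have hk' : 2 * k ≤ N := by have := Finset.mem_range.1 hk; omega
  have : (2 * k : ℝ) ≤ N := by exact_mod_cast hk'
  unfold density
  refine ⟨div_nonneg (by linarith) (by positivity), div_le_one_of_le₀ ?_ (by positivity)⟩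
  have : (0 : ℝ) ≤ k := by positivity
  linarith

lemma densityMean_nonneg (J h : ℝ) (N : ℕ) (f : ℝ → ℝ)
    (hf : ∀ m ∈ Set.Icc (0 : ℝ) 1, 0 ≤ f m) : 0 ≤ densityMean J h N f :=
  Finset.sum_nonneg fun _ hk => mul_nonneg (hf _ (density_mem_Icc hk))
    (div_pos (weight_pos_of_mem_range hk J h) (totalWeight_pos N J h)).le

lemma densityMean_one (J h : ℝ) (N : ℕ) : densityMean J h N (fun _ => 1) = 1 := by
  rw [densityMean_apply]
  simp only [one_mul]
  exact div_self (totalWeight_pos N J h).ne'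

/-! ### Stein's identity -/

lemma density_succ {N : ℕ} (hN : N ≠ 0) (k : ℕ) : density N (k + 1) + 2 / N = density N k := by
  have hN' : (N : ℝ) ≠ 0 := Nat.cast_ne_zero.2 hN
  unfold density
  push_cast
  field_simp
  ring

lemma one_sub_density {N : ℕ} (hN : N ≠ 0) (k : ℕ) : 1 - density N k = 2 * k / N := by
  have hN' : (N : ℝ) ≠ 0 := Nat.cast_ne_zero.2 hN
  unfold density
  field_simp
  ring

/-- Detailed balance for the creation and the annihilation of a dimer. -/
lemma weight_succ {N k : ℕ} (hk : 2 * (k + 1) ≤ N) (J h : ℝ) :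
    (1 - density N (k + 1)) * weight N J h (k + 1)
      = density N k * (density N k - 1 / N)
        * Real.exp (-2 * (h + J * (2 * density N k - 1)) + 4 * J / N) * weight N J h k := by
  have hN : N ≠ 0 := by omega
  obtain ⟨r, rfl⟩ : ∃ r, N = r + 2 * (k + 1) := ⟨N - 2 * (k + 1), by omega⟩
  have hN' : ((r + 2 * (k + 1) : ℕ) : ℝ) ≠ 0 := Nat.cast_ne_zero.2 hN
  have hd : density (r + 2 * (k + 1)) k = (r + 2) / ((r + 2 * (k + 1) : ℕ) : ℝ) := by
    unfold density; push_cast; congr 1; ring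
  have hs := density_succ hN k
  rw [one_sub_density hN]
  unfold weight
  have h2 : r + 2 * (k + 1) - 2 * k = r + 2 := by omega
  have h3 : r + 2 * (k + 1) - 2 * (k + 1) = r := by omega
  rw [h2, h3, Nat.factorial_succ k, Nat.factorial_succ (r + 1), Nat.factorial_succ r, pow_succ,
    pow_succ]
  generalize hNN : ((r + 2 * (k + 1) : ℕ) : ℝ) = n at *
  have hexp : Real.exp (-2 * (h + J * (2 * density (r + 2 * (k + 1)) k - 1)) + 4 * J / n) *
      Real.exp (n * (h * density (r + 2 * (k + 1)) k + J * (density (r + 2 * (k + 1)) k ^ 2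
        - density (r + 2 * (k + 1)) k + 1 / 2)) - J / 2)
      = Real.exp (n * (h * density (r + 2 * (k + 1)) (k + 1)
        + J * (density (r + 2 * (k + 1)) (k + 1) ^ 2
        - density (r + 2 * (k + 1)) (k + 1) + 1 / 2)) - J / 2) := by
    rw [← Real.exp_add, ← hs]
    congr 1
    field_simp
    ring
  rw [← hexp, hd]
  push_cast
  have : (r.factorial : ℝ) ≠ 0 := by positivity
  have : (k.factorial : ℝ) ≠ 0 := by positivity
  field_simp
  ring

/-- Stein's identity for the law of the monomer density. -/
lemma densityMean_stein {N : ℕ} (hN : N ≠ 0) (J h : ℝ) (φ : ℝ → ℝ) :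
    densityMean J h N (fun m => φ (m + 2 / N) * (1 - m))
      = densityMean J h N (fun m => φ m *
        (m * (m - 1 / N) * Real.exp (-2 * (h + J * (2 * m - 1)) + 4 * J / N))) := by
  rw [densityMean_apply, densityMean_apply, Finset.sum_range_succ', Finset.sum_range_succ]
  have hN' : (N : ℝ) ≠ 0 := Nat.cast_ne_zero.2 hN
  -- At the largest number of dimers at most one monomer is left, so that no dimer can be added.
  have hlast : density N (N / 2) * (density N (N / 2) - 1 / N) = 0 := by
    unfold density
    rcases Nat.mod_two_eq_zero_or_one N with h0 | h1
    · have : (N : ℝ) = 2 * (N / 2 : ℕ) := by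
        exact_mod_cast (show N = 2 * (N / 2) by omega)
      rw [← this]; simp
    · have : (N : ℝ) = 2 * (N / 2 : ℕ) + 1 := by
        exact_mod_cast (show N = 2 * (N / 2) + 1 by omega)
      have h2 : (N : ℝ) - 2 * (N / 2 : ℕ) = 1 := by linarith
      rw [h2]; simp
  rw [hlast, one_sub_density hN 0]
  congr 2
  · refine Finset.sum_congr rfl fun k hk => ?_
    have := weight_succ (N := N) (k := k) (by have := Finset.mem_range.1 hk; omega) J h
    rw [density_succ hN, mul_assoc, this]
    ring
  · simp

/-- The function whose zeros in `[0, 1]` solve the consistency equation. It is minus the drift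
of the monomer density under creation and annihilation of dimers. -/
def drift (J h m : ℝ) : ℝ := m ^ 2 * Real.exp (-2 * (h + J * (2 * m - 1))) - (1 - m)

lemma IsEquilibrium.sq_mul_exp {J h m : ℝ} (hm : IsEquilibrium J h m) :
    m ^ 2 * Real.exp (-2 * (h + J * (2 * m - 1))) = 1 - m := by
  have h1 := g_sq ((2 * m - 1) * J + h)
  rw [← hm.2.1] at h1
  rw [h1, mul_right_comm, ← Real.exp_add]
  have : 2 * ((2 * m - 1) * J + h) + -2 * (h + J * (2 * m - 1)) = 0 := by ring
  rw [this, Real.exp_zero, one_mul]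

lemma IsEquilibrium.drift_eq_zero {J h m : ℝ} (hm : IsEquilibrium J h m) : drift J h m = 0 := by
  rw [drift, hm.sq_mul_exp, sub_self]

lemma IsEquilibrium.hasDerivAt_drift {J h m : ℝ} (hm : IsEquilibrium J h m) :
    HasDerivAt (drift J h) (2 * (1 - m) * (1 / m + 1 / (2 * (1 - m)) - 2 * J)) m := by
  have h0 := hm.pos.ne'
  have h1 := (sub_pos.2 hm.lt_one).ne'
  have hid := hasDerivAt_id m
  have e1 := (((((hid.const_mul 2).sub_const 1).const_mul J).const_add h).const_mul (-2)).exp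
  have e := ((hid.pow 2).mul e1).sub (hid.const_sub 1)
  refine e.congr_deriv ?_
  have hq := hm.sq_mul_exp
  have hq' : Real.exp (-2 * (h + J * (2 * m - 1))) = (1 - m) / m ^ 2 := by
    rw [eq_div_iff (by positivity), mul_comm, hq]
  simp only [id, Pi.pow_apply]
  rw [hq']
  field_simp
  ring

lemma continuous_drift (J h : ℝ) : Continuous (drift J h) := by unfold drift; fun_prop

/-! ### Expectations that concentrate -/

section Concentration

variable {E : ℕ → (ℝ → ℝ) →ₗ[ℝ] ℝ}

lemma map_le_map_of_nonneg {L : (ℝ → ℝ) →ₗ[ℝ] ℝ}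
    (hpos : ∀ f, (∀ m ∈ Set.Icc (0 : ℝ) 1, 0 ≤ f m) → 0 ≤ L f) {f f' : ℝ → ℝ}
    (hf : ∀ m ∈ Set.Icc (0 : ℝ) 1, f m ≤ f' m) : L f ≤ L f' := by
  rw [← sub_nonneg, ← map_sub]
  exact hpos _ fun m hm => sub_nonneg.2 (hf m hm)

lemma abs_map_le_of_nonneg {L : (ℝ → ℝ) →ₗ[ℝ] ℝ}
    (hpos : ∀ f, (∀ m ∈ Set.Icc (0 : ℝ) 1, 0 ≤ f m) → 0 ≤ L f) {f f' : ℝ → ℝ}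
    (hf : ∀ m ∈ Set.Icc (0 : ℝ) 1, |f m| ≤ f' m) : |L f| ≤ L f' := by
  rw [abs_le, ← map_neg]
  exact ⟨map_le_map_of_nonneg hpos fun m hm => (abs_le.1 (hf m hm)).1,
    map_le_map_of_nonneg hpos fun m hm => (abs_le.1 (hf m hm)).2⟩

lemma sq_map_le_of_nonneg {L : (ℝ → ℝ) →ₗ[ℝ] ℝ}
    (hpos : ∀ f, (∀ m ∈ Set.Icc (0 : ℝ) 1, 0 ≤ f m) → 0 ≤ L f) (hone : L (fun _ => 1) = 1)
    (f : ℝ → ℝ) : L f ^ 2 ≤ L (fun m => f m ^ 2) := by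
  have h := hpos (fun m => (f m - L f) ^ 2) fun m _ => sq_nonneg _
  have hf : (fun m => (f m - L f) ^ 2)
      = (fun m => f m ^ 2) - (2 * L f) • f + (L f ^ 2) • (fun _ => (1 : ℝ)) := by
    ext m; simp; ring
  rw [hf, map_add, map_sub, map_smul, map_smul, hone] at h
  simp only [smul_eq_mul] at h
  linarith

/-- The indicator function of the complement of the `ε`-neighbourhood of `M`. -/
def farFrom (M ε : ℝ) (m : ℝ) : ℝ := if ε ≤ |m - M| then 1 else 0

lemma farFrom_nonneg (M ε m : ℝ) : 0 ≤ farFrom M ε m := by unfold farFrom; split_ifs <;> norm_num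

lemma farFrom_le_one (M ε m : ℝ) : farFrom M ε m ≤ 1 := by unfold farFrom; split_ifs <;> norm_num

/-- Linearization at `M`, up to a small relative error near `M` and a bounded one far away. -/
lemma exists_abs_sub_linear_le {F : ℝ → ℝ} {κ M C : ℝ} (hM : M ∈ Set.Icc (0 : ℝ) 1)
    (hκ : 0 < κ) (hF : HasDerivAt F κ M) (hFM : F M = 0)
    (hC : ∀ m ∈ Set.Icc (0 : ℝ) 1, |F m| ≤ C) {η : ℝ} (hη : 0 < η) :
    ∃ ε > 0, ∀ m ∈ Set.Icc (0 : ℝ) 1,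
      |F m - κ * (m - M)| ≤ η * |m - M| + (C + κ) * farFrom M ε m := by
  have h := (hasDerivAt_iff_isLittleO.1 hF).def hη
  obtain ⟨ε, hε, hball⟩ := Metric.eventually_nhds_iff.1 h
  refine ⟨ε, hε, fun m hm => ?_⟩
  by_cases hfar : ε ≤ |m - M|
  · have hx : |m - M| ≤ 1 := by
      rw [abs_le]; constructor <;> linarith [hm.1, hm.2, hM.1, hM.2]
    rw [farFrom, if_pos hfar, mul_one]
    have h1 : |F m - κ * (m - M)| ≤ |F m| + |κ * (m - M)| := abs_sub _ _
    rw [abs_mul, abs_of_pos hκ] at h1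
    have h2 : κ * |m - M| ≤ κ * 1 := mul_le_mul_of_nonneg_left hx hκ.le
    have h3 := mul_nonneg hη.le (abs_nonneg (m - M))
    linarith [hC m hm]
  · have := hball (y := m) (by rw [Real.dist_eq]; exact not_le.1 hfar)
    rw [hFM, Real.norm_eq_abs, Real.norm_eq_abs, sub_zero, smul_eq_mul, mul_comm (m - M)] at this
    rw [farFrom, if_neg hfar, mul_zero, add_zero]
    exact this

lemma tendsto_map_abs_sub {M : ℝ} (hM : M ∈ Set.Icc (0 : ℝ) 1)
    (hpos : ∀ N f, (∀ m ∈ Set.Icc (0 : ℝ) 1, 0 ≤ f m) → 0 ≤ E N f)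
    (hone : ∀ N, E N (fun _ => 1) = 1)
    (hconc : ∀ ε > 0, Tendsto (fun N : ℕ => N * E N (farFrom M ε)) atTop (𝓝 0)) :
    Tendsto (fun N => E N (fun m => |m - M|)) atTop (𝓝 0) := by
  refine Metric.tendsto_nhds.2 fun ε hε => ?_
  have h1 := (hconc (ε / 2) (by positivity)).eventually_lt_const (show 0 < ε / 2 by positivity)
  filter_upwards [h1, eventually_ge_atTop 1] with N hN hN1
  have hN1' : (1 : ℝ) ≤ N := by exact_mod_cast hN1
  have h0 : 0 ≤ E N (fun m => |m - M|) := hpos N _ fun m _ => abs_nonneg _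
  rw [Real.dist_eq, sub_zero, abs_of_nonneg h0]
  have h2 : E N (fun m => |m - M|) ≤ E N ((ε / 2) • (fun _ => (1 : ℝ)) + farFrom M (ε / 2)) := by
    refine map_le_map_of_nonneg (hpos N) fun m hm => ?_
    have hx : |m - M| ≤ 1 := by
      rw [abs_le]; constructor <;> linarith [hm.1, hm.2, hM.1, hM.2]
    simp only [Pi.add_apply, Pi.smul_apply, smul_eq_mul, mul_one, farFrom]
    split_ifs with hfar <;> linarith
  rw [map_add, map_smul, hone, smul_eq_mul, mul_one] at h2
  have h3 : E N (farFrom M (ε / 2)) ≤ N * E N (farFrom M (ε / 2)) :=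
    le_mul_of_one_le_left (hpos N _ fun m _ => farFrom_nonneg _ _ _) hN1'
  linarith

/-- If `F` has a simple zero at `M`, if the law of `m` concentrates at `M`, if
`N E[(m - M) F(m)]` tends to `b` and if `E[F(m)]` is `o(N ^ (-1/2))`, then the variance of `m` is
asymptotic to `b / (F'(M) N)`. -/
theorem tendsto_variance {F : ℝ → ℝ} {κ M C b : ℝ} (hM : M ∈ Set.Icc (0 : ℝ) 1)
    (hpos : ∀ N f, (∀ m ∈ Set.Icc (0 : ℝ) 1, 0 ≤ f m) → 0 ≤ E N f)
    (hone : ∀ N, E N (fun _ => 1) = 1)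
    (hconc : ∀ ε > 0, Tendsto (fun N : ℕ => N * E N (farFrom M ε)) atTop (𝓝 0))
    (hκ : 0 < κ) (hF : HasDerivAt F κ M) (hFM : F M = 0)
    (hC : ∀ m ∈ Set.Icc (0 : ℝ) 1, |F m| ≤ C)
    (hb : Tendsto (fun N : ℕ => N * E N (fun m => (m - M) * F m)) atTop (𝓝 b))
    (hF0 : Tendsto (fun N : ℕ => N * E N F ^ 2) atTop (𝓝 0)) :
    Tendsto (fun N : ℕ => N * (E N (fun m => m ^ 2) - E N (fun m => m) ^ 2)) atTop
      (𝓝 (b / κ)) := by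
  have hC0 : 0 ≤ C := (abs_nonneg _).trans (hC M hM)
  set a : ℕ → ℝ := fun N => N * E N (fun m => (m - M) ^ 2) with ha
  have hsq0 : ∀ N, 0 ≤ E N (fun m => (m - M) ^ 2) := fun N => hpos N _ fun m _ => sq_nonneg _
  have ha0 : ∀ N, 0 ≤ a N := fun N => mul_nonneg (by positivity) (hsq0 N)
  -- `N E[(m - M) F(m)]` is `κ N E[(m - M)²]` up to a small multiple of `N E[(m - M)²]`.
  have hlin2 : ∀ η > 0, ∃ ε > 0, ∀ N : ℕ, |N * E N (fun m => (m - M) * F m) - κ * a N|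
      ≤ η * a N + (C + κ) * (N * E N (farFrom M ε)) := by
    intro η hη
    obtain ⟨ε, hε, hlin⟩ := exists_abs_sub_linear_le hM hκ hF hFM hC hη
    refine ⟨ε, hε, fun N => ?_⟩
    have h1 : |E N ((fun m => (m - M) * F m) - κ • (fun m => (m - M) ^ 2))|
        ≤ E N (η • (fun m => (m - M) ^ 2) + (C + κ) • farFrom M ε) := by
      refine abs_map_le_of_nonneg (hpos N) fun m hm => ?_
      have hx : |m - M| ≤ 1 := by
        rw [abs_le]; constructor <;> linarith [hm.1, hm.2, hM.1, hM.2]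
      simp only [Pi.sub_apply, Pi.add_apply, Pi.smul_apply, smul_eq_mul]
      have h2 : (m - M) * F m - κ * (m - M) ^ 2 = (m - M) * (F m - κ * (m - M)) := by ring
      rw [h2, abs_mul]
      calc |m - M| * |F m - κ * (m - M)|
          ≤ |m - M| * (η * |m - M| + (C + κ) * farFrom M ε m) :=
            mul_le_mul_of_nonneg_left (hlin m hm) (abs_nonneg _)
        _ = η * |m - M| ^ 2 + |m - M| * ((C + κ) * farFrom M ε m) := by ring
        _ ≤ η * (m - M) ^ 2 + (C + κ) * farFrom M ε m := by
            rw [sq_abs]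
            have := mul_le_mul_of_nonneg_right hx
              (mul_nonneg (add_nonneg hC0 hκ.le) (farFrom_nonneg M ε m))
            linarith
    rw [map_sub, map_add, map_smul, map_smul, map_smul] at h1
    simp only [smul_eq_mul] at h1
    have h2 := mul_le_mul_of_nonneg_left h1 (Nat.cast_nonneg (α := ℝ) N)
    rw [← abs_of_nonneg (Nat.cast_nonneg (α := ℝ) N), ← abs_mul,
      abs_of_nonneg (Nat.cast_nonneg (α := ℝ) N)] at h2
    calc |N * E N (fun m => (m - M) * F m) - κ * a N|
        = |N * (E N (fun m => (m - M) * F m) - κ * E N (fun m => (m - M) ^ 2))| := by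
          rw [ha]; congr 1; ring
      _ ≤ _ := h2
      _ = _ := by rw [ha]; ring
  have hp : ∀ ε > 0, ∀ η > 0, ∀ᶠ N : ℕ in atTop, (C + κ) * (N * E N (farFrom M ε)) < η := by
    intro ε hε η hη
    have := (hconc ε hε).const_mul (C + κ)
    rw [mul_zero] at this
    exact this.eventually_lt_const hη
  -- With the multiple `κ / 2` this bounds `N E[(m - M)²]`; arbitrarily small multiples then give
  -- its limit.
  obtain ⟨A, hA0, hA⟩ : ∃ A > 0, ∀ᶠ N in atTop, a N ≤ A := by
    obtain ⟨ε, hε, hl⟩ := hlin2 (κ / 2) (by positivity)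
    have hA0 : 0 < 2 * (|b| + 2) / κ := by positivity
    refine ⟨2 * (|b| + 2) / κ, hA0, ?_⟩
    filter_upwards [hp ε hε 1 one_pos, hb.eventually_lt_const (show b < |b| + 1 by
      linarith [le_abs_self b])] with N h1 h2
    have h3 := (abs_le.1 (hl N)).1
    rw [le_div_iff₀ hκ]
    linarith
  have ha_lim : Tendsto (fun N : ℕ => N * E N (fun m => (m - M) * F m) - κ * a N) atTop
      (𝓝 0) := by
    refine Metric.tendsto_nhds.2 fun ε' hε' => ?_
    obtain ⟨ε, hε, hl⟩ := hlin2 (ε' / (2 * A)) (by positivity)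
    filter_upwards [hp ε hε (ε' / 2) (by positivity), hA] with N h1 h2
    rw [Real.dist_eq, sub_zero]
    have h3 : ε' / (2 * A) * a N ≤ ε' / (2 * A) * A :=
      mul_le_mul_of_nonneg_left h2 (by positivity)
    have h4 : ε' / (2 * A) * A = ε' / 2 := by field_simp
    linarith [hl N]
  have ha' : Tendsto a atTop (𝓝 (b / κ)) := by
    have := (hb.sub ha_lim).div_const κ
    rw [sub_zero] at this
    refine this.congr fun N => ?_
    field_simp
    ring
  -- `κ E[m - M]` differs from `E[F(m)]` by a small multiple of `E|m - M|`, which is at most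
  -- `E[(m - M)²] ^ (1 / 2) = O(N ^ (-1 / 2))`.
  have hmean : Tendsto (fun N : ℕ => N * E N (fun m => m - M) ^ 2) atTop (𝓝 0) := by
    refine Metric.tendsto_nhds.2 fun ε' hε' => ?_
    obtain ⟨η, hη, hηA⟩ : ∃ η > 0, 3 * η ^ 2 * A = κ ^ 2 * ε' / 2 := by
      refine ⟨Real.sqrt (κ ^ 2 * ε' / (6 * A)), by positivity, ?_⟩
      rw [Real.sq_sqrt (by positivity)]
      field_simp
      norm_num
    obtain ⟨ε, hε, hlin⟩ := exists_abs_sub_linear_le hM hκ hF hFM hC hη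
    have hlim : Tendsto (fun N : ℕ => 3 * (N * E N F ^ 2)
        + 3 * (C + κ) ^ 2 * (N * E N (farFrom M ε))) atTop (𝓝 0) := by
      simpa using (hF0.const_mul 3).add ((hconc ε hε).const_mul (3 * (C + κ) ^ 2))
    filter_upwards [hlim.eventually_lt_const (show 0 < κ ^ 2 * ε' / 2 by positivity), hA]
      with N h1 h2
    have hN0 : (0 : ℝ) ≤ N := by positivity
    rw [Real.dist_eq, sub_zero, abs_of_nonneg (by positivity)]
    have h3 : |E N (F - κ • (fun m => m - M))|
        ≤ E N (η • (fun m => |m - M|) + (C + κ) • farFrom M ε) :=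
      abs_map_le_of_nonneg (hpos N) fun m hm => hlin m hm
    rw [map_sub, map_add, map_smul, map_smul, map_smul] at h3
    simp only [smul_eq_mul] at h3
    have h4 := sq_map_le_of_nonneg (hpos N) (hone N) (fun m => |m - M|)
    simp only [sq_abs] at h4
    have hP0 : 0 ≤ E N (farFrom M ε) := hpos N _ fun m _ => farFrom_nonneg _ _ _
    have hP1 : E N (farFrom M ε) ≤ 1 := by
      rw [← hone N]
      exact map_le_map_of_nonneg (hpos N) fun m _ => farFrom_le_one _ _ _
    have habs0 : 0 ≤ E N (fun m => |m - M|) := hpos N _ fun m _ => abs_nonneg _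
    have h5 : κ * |E N (fun m => m - M)| ≤ |E N F| + η * E N (fun m => |m - M|)
        + (C + κ) * E N (farFrom M ε) := by
      have := abs_sub_abs_le_abs_sub (κ * E N (fun m => m - M)) (E N F)
      rw [abs_sub_comm, abs_mul, abs_of_pos hκ] at this
      linarith
    have h6 : κ ^ 2 * E N (fun m => m - M) ^ 2 ≤ 3 * (E N F ^ 2
        + η ^ 2 * E N (fun m => (m - M) ^ 2) + (C + κ) ^ 2 * E N (farFrom M ε)) := by
      have h7 : (κ * |E N (fun m => m - M)|) ^ 2 ≤ (|E N F| + η * E N (fun m => |m - M|)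
        + (C + κ) * E N (farFrom M ε)) ^ 2 := pow_le_pow_left₀ (by positivity) h5 2
      have h8 : ∀ x y z : ℝ, (x + y + z) ^ 2 ≤ 3 * (x ^ 2 + y ^ 2 + z ^ 2) := fun x y z => by
        nlinarith [sq_nonneg (x - y), sq_nonneg (y - z), sq_nonneg (x - z)]
      have h9 := h7.trans (h8 _ _ _)
      rw [mul_pow, mul_pow, mul_pow, sq_abs, sq_abs] at h9
      have h10 : E N (farFrom M ε) ^ 2 ≤ E N (farFrom M ε) := by
        rw [sq]; exact mul_le_of_le_one_left hP0 hP1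
      have h11 := mul_le_mul_of_nonneg_left h4 (sq_nonneg η)
      have h12 := mul_le_mul_of_nonneg_left h10 (sq_nonneg (C + κ))
      linarith
    have h7 := mul_le_mul_of_nonneg_left h6 hN0
    have h8 : 3 * η ^ 2 * a N ≤ 3 * η ^ 2 * A := mul_le_mul_of_nonneg_left h2 (by positivity)
    rw [hηA] at h8
    have h9 : κ ^ 2 * (N * E N (fun m => m - M) ^ 2) < κ ^ 2 * ε' := by
      simp only [ha] at h8
      linarith
    exact lt_of_mul_lt_mul_left h9 (by positivity)
  have := ha'.sub hmean
  rw [sub_zero] at this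
  refine this.congr fun N => ?_
  have e1 : E N (fun m => (m - M) ^ 2)
      = E N (fun m => m ^ 2) - 2 * M * E N (fun m => m) + M ^ 2 := by
    have : (fun m => (m - M) ^ 2)
        = (fun m => m ^ 2) - (2 * M) • (fun m => m) + (M ^ 2) • (fun _ => (1 : ℝ)) := by
      ext m; simp; ring
    rw [this, map_add, map_sub, map_smul, map_smul, hone]
    simp
  have e2 : E N (fun m => m - M) = E N (fun m => m) - M := by
    have : (fun m => m - M) = (fun m => m) - M • (fun _ => (1 : ℝ)) := by ext m; simp
    rw [this, map_sub, map_smul, hone]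
    simp
  simp only [ha, e1, e2]
  ring

end Concentration

/-! ### Consequences of Stein's identity -/

/-- The expectation of `φ * drift` in terms of the increments of `φ`, up to an error of order
`1 / N`. -/
lemma abs_mul_densityMean_drift_sub_le {J : ℝ} (hJ : 0 ≤ J) (h : ℝ) :
    ∃ C, 0 ≤ C ∧ ∀ N : ℕ, N ≠ 0 → ∀ φ : ℝ → ℝ,
      |N * densityMean J h N (fun m => φ m * drift J h m)
        - densityMean J h N (fun m => N * (φ (m + 2 / N) - φ m) * (1 - m))|
      ≤ C * densityMean J h N (fun m => |φ m|) := by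
  refine ⟨Real.exp (2 * (|h| + J)) * ((4 * J + 1) * Real.exp (4 * J)), by positivity,
    fun N hN φ => ?_⟩
  have hN' : (N : ℝ) ≠ 0 := Nat.cast_ne_zero.2 hN
  have hN1 : (1 : ℝ) ≤ N := by exact_mod_cast Nat.one_le_iff_ne_zero.2 hN
  have hst := densityMean_stein hN J h φ
  set y := 4 * J / N with hy
  have hy0 : 0 ≤ y := by positivity
  have hyJ : y ≤ 4 * J := div_le_self (by positivity) hN1
  have hr1 : Real.exp y ≤ Real.exp (4 * J) := Real.exp_le_exp.2 hyJ
  have hr0 : 1 ≤ Real.exp y := Real.one_le_exp hy0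
  have hr2 : N * (Real.exp y - 1) ≤ 4 * J * Real.exp (4 * J) := by
    have h1 := Real.one_sub_le_exp_neg y
    rw [Real.exp_neg] at h1
    have h2 := mul_le_mul_of_nonneg_right h1 (Real.exp_pos y).le
    rw [inv_mul_cancel₀ (Real.exp_pos y).ne'] at h2
    have h3 : N * y = 4 * J := by rw [hy]; field_simp
    calc N * (Real.exp y - 1) ≤ N * (y * Real.exp y) :=
          mul_le_mul_of_nonneg_left (by linarith) (by positivity)
      _ = 4 * J * Real.exp y := by rw [← mul_assoc, h3]
      _ ≤ 4 * J * Real.exp (4 * J) := mul_le_mul_of_nonneg_left hr1 (by positivity)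
  have hsplit : (fun m => φ m * drift J h m)
      = (fun m => φ m * (m * (m - 1 / N) * Real.exp (-2 * (h + J * (2 * m - 1)) + y)))
        - (fun m => φ m * (1 - m)) - (1 / N : ℝ) • (fun m => φ m *
          (Real.exp (-2 * (h + J * (2 * m - 1))) * m * (N * (Real.exp y - 1) * m - Real.exp y))) := by
    ext m
    simp only [Pi.sub_apply, Pi.smul_apply, smul_eq_mul, drift, Real.exp_add]
    field_simp
    ring
  have hinc : (fun m => N * (φ (m + 2 / N) - φ m) * (1 - m))
      = (N : ℝ) • ((fun m => φ (m + 2 / N) * (1 - m)) - (fun m => φ m * (1 - m))) := by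
    ext m
    simp only [Pi.sub_apply, Pi.smul_apply, smul_eq_mul]
    ring
  rw [hsplit, hinc, map_smul, map_sub, map_sub, map_sub, map_smul, hst, smul_eq_mul, smul_eq_mul]
  have hcalc : ∀ x y z : ℝ, N * (x - y - 1 / N * z) - N * (x - y) = -z := fun x y z => by
    field_simp
    ring
  rw [hcalc, abs_neg, ← smul_eq_mul (_ * (_ * _)), ← map_smul]
  refine abs_map_le_of_nonneg (densityMean_nonneg J h N) fun m hm => ?_
  rw [Pi.smul_apply, smul_eq_mul, abs_mul, mul_comm]
  refine mul_le_mul_of_nonneg_right ?_ (abs_nonneg _)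
  rw [abs_mul, abs_mul, Real.abs_exp, abs_of_nonneg hm.1]
  have hq : Real.exp (-2 * (h + J * (2 * m - 1))) ≤ Real.exp (2 * (|h| + J)) := by
    rw [Real.exp_le_exp]
    have := neg_abs_le h
    have := mul_nonneg hJ hm.1
    nlinarith
  have hq' : Real.exp (-2 * (h + J * (2 * m - 1))) * m ≤ Real.exp (2 * (|h| + J)) :=
    (mul_le_of_le_one_right (Real.exp_pos _).le hm.2).trans hq
  refine mul_le_mul hq' ?_ (abs_nonneg _) (by positivity)
  have h0 : 0 ≤ N * (Real.exp y - 1) := mul_nonneg (by positivity) (by linarith)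
  have h1 : N * (Real.exp y - 1) * m ≤ N * (Real.exp y - 1) := mul_le_of_le_one_right h0 hm.2
  have h2 : 0 ≤ N * (Real.exp y - 1) * m := mul_nonneg h0 hm.1
  rw [abs_le]
  constructor <;> nlinarith [Real.exp_pos y, Real.exp_pos (4 * J)]

/-! ### Large deviations of the monomer density -/

lemma log_factorial_ge (n : ℕ) : n * Real.log n - n ≤ Real.log n.factorial := by
  induction n with
  | zero => simp
  | succ n ih =>
    rw [Nat.factorial_succ, Nat.cast_mul, Real.log_mul (by positivity) (by positivity)]
    rcases Nat.eq_zero_or_pos n with rfl | hn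
    · simp
    · have hn' : (0 : ℝ) < n := by exact_mod_cast hn
      have h1 := Real.log_le_sub_one_of_pos (show (0 : ℝ) < ((n + 1 : ℕ) : ℝ) / n by positivity)
      rw [Real.log_div (by positivity) hn'.ne'] at h1
      have h2 := mul_le_mul_of_nonneg_left h1 hn'.le
      have h3 : (n : ℝ) * (((n + 1 : ℕ) : ℝ) / n - 1) = 1 := by push_cast; field_simp; ring
      push_cast at *
      linarith

lemma log_factorial_le (n : ℕ) :
    Real.log n.factorial ≤ n * Real.log n - n + (Real.log (n + 1) + 1) := by
  rcases Nat.eq_zero_or_pos n with rfl | hn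
  · simp
  suffices Real.log n.factorial ≤ n * Real.log n - n + (Real.log n + 1) by
    have h1 : (0 : ℝ) < n := by exact_mod_cast hn
    have := Real.log_le_log h1 (show (n : ℝ) ≤ n + 1 by linarith)
    linarith
  induction n, hn using Nat.le_induction with
  | base => simp
  | succ n hn ih =>
    rw [Nat.factorial_succ, Nat.cast_mul, Real.log_mul (by positivity) (by positivity)]
    have hn' : (0 : ℝ) < n := by exact_mod_cast hn
    have h1 := Real.one_sub_inv_le_log_of_pos
      (show (0 : ℝ) < ((n + 1 : ℕ) : ℝ) / n by positivity)
    rw [Real.log_div (by positivity) hn'.ne'] at h1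
    have h2 := mul_le_mul_of_nonneg_left h1 (show (0 : ℝ) ≤ ((n + 1 : ℕ) : ℝ) by positivity)
    have h3 : ((n + 1 : ℕ) : ℝ) * (1 - (((n + 1 : ℕ) : ℝ) / n)⁻¹) = 1 := by
      push_cast; field_simp; ring
    push_cast at *
    linarith

lemma mul_log_div {x y z : ℝ} (hy : y ≠ 0) (hz : z ≠ 0) :
    x * Real.log (z * x / y) = x * (Real.log z + Real.log x - Real.log y) := by
  rcases eq_or_ne x 0 with rfl | hx
  · simp
  · rw [Real.log_div (mul_ne_zero hz hx) hy, Real.log_mul hz hx]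

/-- The rate function gives the logarithm of the weights up to `O(log N)`. -/
lemma log_weight_bounds {N k : ℕ} (hN : N ≠ 0) (hk : 2 * k ≤ N) (J h : ℝ) :
    N * rate J h (density N k) - J / 2 - 2 * (Real.log (N + 1) + 1)
        ≤ Real.log (weight N J h k) ∧
      Real.log (weight N J h k)
        ≤ N * rate J h (density N k) - J / 2 + (Real.log (N + 1) + 1) := by
  have hN' : (N : ℝ) ≠ 0 := Nat.cast_ne_zero.2 hN
  obtain ⟨r, hr⟩ : ∃ r, r = N - 2 * k := ⟨_, rfl⟩
  have hrN : (N : ℝ) = r + 2 * k := by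
    exact_mod_cast (show N = r + 2 * k by omega)
  have hd : density N k = 1 * r / N := by
    unfold density; rw [hrN]; congr 1; ring
  have hd1 : 1 - density N k = 2 * k / N := one_sub_density hN k
  have hlog : Real.log (weight N J h k) = Real.log N.factorial - Real.log k.factorial
      - Real.log r.factorial - k * Real.log 2 - k * Real.log N
      + (N * (h * density N k + J * (density N k ^ 2 - density N k + 1 / 2)) - J / 2) := by
    unfold weight
    rw [← hr, Real.log_mul (by positivity) (by positivity), Real.log_exp,
      Real.log_div (by positivity) (by positivity), Real.log_div (by positivity) (by positivity),
      Real.log_mul (by positivity) (by positivity), Real.log_mul (by positivity) (by positivity),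
      Real.log_pow, Real.log_pow]
    ring
  have hent : N * entropy (density N k) = (N * Real.log N - N) - (k * Real.log k - k)
      - (r * Real.log r - r) - k * Real.log 2 - k * Real.log N := by
    have e1 := mul_log_div (x := (r : ℝ)) hN' one_ne_zero
    have e2 := mul_log_div (x := (k : ℝ)) hN' two_ne_zero
    rw [Real.log_one] at e1
    have : N * entropy (density N k) = -k - k * Real.log (2 * k / N)
        - r * Real.log (1 * r / N) := by
      unfold entropy
      rw [hd1, hd]
      field_simp
    rw [this, e1, e2]
    linear_combination Real.log N * (-hrN) + hrN
  have hrate : N * rate J h (density N k) = N * entropy (density N k)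
      + N * (h * density N k + J * (density N k ^ 2 - density N k + 1 / 2)) := by
    unfold rate; ring
  have hkN : Real.log ((k : ℝ) + 1) ≤ Real.log (N + 1) :=
    Real.log_le_log (by positivity) (by
      have : (k : ℝ) ≤ N := by exact_mod_cast (show k ≤ N by omega)
      linarith)
  have hrN' : Real.log ((r : ℝ) + 1) ≤ Real.log (N + 1) :=
    Real.log_le_log (by positivity) (by
      have : (r : ℝ) ≤ N := by exact_mod_cast (show r ≤ N by omega)
      linarith)
  have a1 := log_factorial_ge N
  have a2 := log_factorial_le N
  have b1 := log_factorial_ge k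
  have b2 := log_factorial_le k
  have c1 := log_factorial_ge r
  have c2 := log_factorial_le r
  rw [hlog, hrate, hent]
  constructor <;> linarith

/-- The densities attainable on `N` vertices approximate every density. -/
lemma exists_density_tendsto {M : ℝ} (hM : M ∈ Set.Icc (0 : ℝ) 1) :
    ∃ k : ℕ → ℕ, (∀ N, 2 * k N ≤ N) ∧ Tendsto (fun N => density N (k N)) atTop (𝓝 M) := by
  have h0 : 0 ≤ (1 - M) / 2 := by linarith [hM.2]
  refine ⟨fun N => ⌊(1 - M) / 2 * (N : ℝ)⌋₊, fun N => ?_, ?_⟩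
  · have h1 : (⌊(1 - M) / 2 * (N : ℝ)⌋₊ : ℝ) ≤ (1 - M) / 2 * N :=
      Nat.floor_le (by positivity)
    have h2 : 0 ≤ M * N := mul_nonneg hM.1 (by positivity)
    have : (2 * ⌊(1 - M) / 2 * (N : ℝ)⌋₊ : ℝ) ≤ N := by linarith
    exact_mod_cast this
  · have h1 := (tendsto_nat_floor_mul_div_atTop h0).comp (tendsto_natCast_atTop_atTop (R := ℝ))
    have h2 := (h1.const_mul 2).const_sub 1
    have h3 : 1 - 2 * ((1 - M) / 2) = M := by ring
    rw [h3] at h2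
    refine h2.congr' ?_
    filter_upwards [eventually_ne_atTop 0] with N hN
    have := one_sub_density hN ⌊(1 - M) / 2 * (N : ℝ)⌋₊
    simp only [Function.comp]
    rw [← mul_div_assoc]
    linarith

/-- Exponential concentration of the monomer density at the unique equilibrium value. -/
lemma tendsto_mul_densityMean_farFrom {J h : ℝ} (hJ : 0 ≤ J)
    (hcoex : (J, h) ∉ coexistenceCurve) {ε : ℝ} (hε : 0 < ε) :
    Tendsto (fun N : ℕ => N * densityMean J h N (farFrom (limitDensity J h) ε)) atTop (𝓝 0) := by
  set M := limitDensity J h with hMdef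
  obtain ⟨δ, hδ, hgap⟩ := exists_rate_gap hJ hcoex hε
  obtain ⟨k₀, hk₀, hlim⟩ := exists_density_tendsto (isEquilibrium_limitDensity hJ h).1
  have hrate : ∀ᶠ N : ℕ in atTop, rate J h M - δ / 2 < rate J h (density N (k₀ N)) :=
    (((continuous_rate J h).tendsto _).comp hlim).eventually_const_lt (by linarith)
  have hbound : ∀ᶠ N : ℕ in atTop, N * densityMean J h N (farFrom M ε)
      ≤ Real.exp 3 * Real.exp (δ / 2)
        * (((N + 1 : ℕ) : ℝ) ^ 5 * Real.exp (-(δ / 2)) ^ (N + 1)) := by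
    filter_upwards [hrate, eventually_ne_atTop 0] with N hN hN0
    have hNpos : (0 : ℝ) < N := by positivity
    have hL : Real.exp (Real.log (N + 1) + 1) ^ 3 = Real.exp 3 * (N + 1) ^ 3 := by
      rw [Real.exp_add, Real.exp_log (by positivity), mul_pow, ← Real.exp_nat_mul]
      norm_num
      ring
    have hmem₀ : k₀ N ∈ Finset.range (N / 2 + 1) := by
      have := hk₀ N
      rw [Finset.mem_range]
      omega
    have hterm : ∀ k ∈ Finset.range (N / 2 + 1), farFrom M ε (density N k) * weight N J h k
        ≤ Real.exp 3 * (N + 1) ^ 3 * Real.exp (-(δ / 2)) ^ N * totalWeight N J h := by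
      intro k hk
      have hZ := totalWeight_pos N J h
      unfold farFrom
      split_ifs with hfar
      · -- Compare with the weight of a density close to `M`; the Stirling errors of the two
        -- weights contribute the factor `(exp 1 * (N + 1)) ^ 3`.
        rw [one_mul]
        have hk2 : 2 * k ≤ N := by
          have := Finset.mem_range.1 hk
          omega
        have h1 := (log_weight_bounds hN0 hk2 J h).2
        have h2 := (log_weight_bounds hN0 (hk₀ N) J h).1
        have h3 := hgap _ (density_mem_Icc hk) hfar
        have h4 : (N : ℝ) * rate J h (density N k)
            ≤ N * rate J h (density N (k₀ N)) + N * (-(δ / 2)) := by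
          rw [← mul_add]
          exact mul_le_mul_of_nonneg_left (by linarith) hNpos.le
        have h5 : weight N J h k ≤ Real.exp (Real.log (N + 1) + 1) ^ 3
            * Real.exp (-(δ / 2)) ^ N * weight N J h (k₀ N) := by
          rw [← Real.log_le_log_iff (weight_pos hN0 J h k)
            (mul_pos (by positivity) (weight_pos hN0 J h _)),
            Real.log_mul (by positivity) (weight_pos hN0 J h _).ne',
            Real.log_mul (by positivity) (by positivity), Real.log_pow, Real.log_pow,
            Real.log_exp, Real.log_exp]
          push_cast
          linarith
        rw [hL] at h5
        refine h5.trans (mul_le_mul_of_nonneg_left ?_ (by positivity))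
        exact Finset.single_le_sum (fun i hi => (weight_pos_of_mem_range hi J h).le) hmem₀
      · rw [zero_mul]
        positivity
    have hsum := Finset.sum_le_card_nsmul _ _ _ hterm
    rw [Finset.card_range, nsmul_eq_mul] at hsum
    have hcard : ((N / 2 + 1 : ℕ) : ℝ) ≤ N + 1 := by
      exact_mod_cast (show N / 2 + 1 ≤ N + 1 by omega)
    have hmean : densityMean J h N (farFrom M ε)
        ≤ (N + 1) * (Real.exp 3 * (N + 1) ^ 3 * Real.exp (-(δ / 2)) ^ N) := by
      rw [densityMean_apply, div_le_iff₀ (totalWeight_pos N J h)]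
      refine hsum.trans ?_
      rw [mul_assoc (N + 1 : ℝ)]
      exact mul_le_mul_of_nonneg_right hcard
        (mul_nonneg (by positivity) (totalWeight_pos N J h).le)
    calc N * densityMean J h N (farFrom M ε)
        ≤ (N + 1) * ((N + 1) * (Real.exp 3 * (N + 1) ^ 3 * Real.exp (-(δ / 2)) ^ N)) :=
          mul_le_mul (by linarith) hmean
            (densityMean_nonneg J h N _ fun m _ => farFrom_nonneg _ _ _) (by positivity)
      _ = Real.exp 3 * (Real.exp (δ / 2) * Real.exp (-(δ / 2)))
            * ((N + 1) ^ 5 * Real.exp (-(δ / 2)) ^ N) := by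
          rw [← Real.exp_add, add_neg_cancel, Real.exp_zero]; ring
      _ = _ := by push_cast; ring
  have hzero : Tendsto (fun N : ℕ => Real.exp 3 * Real.exp (δ / 2)
      * (((N + 1 : ℕ) : ℝ) ^ 5 * Real.exp (-(δ / 2)) ^ (N + 1))) atTop (𝓝 0) := by
    have h1 := tendsto_pow_const_mul_const_pow_of_abs_lt_one 5
      (show |Real.exp (-(δ / 2))| < 1 by
        rw [Real.abs_exp, Real.exp_lt_one_iff]; linarith)
    have h2 := ((tendsto_add_atTop_iff_nat 1).2 h1).const_mul (Real.exp 3 * Real.exp (δ / 2))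
    rwa [mul_zero] at h2
  exact tendsto_of_tendsto_of_tendsto_of_le_of_le' tendsto_const_nhds hzero
    (Eventually.of_forall fun N => mul_nonneg (by positivity)
      (densityMean_nonneg J h N _ fun m _ => farFrom_nonneg _ _ _)) hbound

/-! ### Convergence of the density and of the susceptibility -/

lemma tendsto_densityMean {J h : ℝ} (hJ : 0 ≤ J) (hcoex : (J, h) ∉ coexistenceCurve) :
    Tendsto (fun N => densityMean J h N (fun m => m)) atTop (𝓝 (limitDensity J h)) := by
  have h1 := tendsto_map_abs_sub (isEquilibrium_limitDensity hJ h).1 (densityMean_nonneg J h)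
    (densityMean_one J h) (fun ε hε => tendsto_mul_densityMean_farFrom hJ hcoex hε)
  rw [tendsto_iff_norm_sub_tendsto_zero]
  refine squeeze_zero (fun N => norm_nonneg _) (fun N => ?_) h1
  have h2 : densityMean J h N (fun m => m) - limitDensity J h
      = densityMean J h N ((fun m => m) - limitDensity J h • (fun _ => (1 : ℝ))) := by
    rw [map_sub, map_smul, densityMean_one, smul_eq_mul, mul_one]
  rw [h2, Real.norm_eq_abs]
  refine abs_map_le_of_nonneg (densityMean_nonneg J h N) fun m _ => ?_
  simp

theorem tendsto_susceptibility {J h : ℝ} (hJ : 0 ≤ J) (hcoex : (J, h) ∉ coexistenceCurve)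
    (hcrit : (J, h) ≠ criticalPoint) :
    Tendsto (fun N => susceptibility N J h) atTop
      (𝓝 (1 / limitDensity J h + 1 / (2 * (1 - limitDensity J h)) - 2 * J)⁻¹) := by
  have heq := isEquilibrium_limitDensity hJ h
  have hneg := deriv2_rate_neg hJ hcoex hcrit
  have hconc := fun ε (hε : ε > 0) => tendsto_mul_densityMean_farFrom hJ hcoex hε
  have hmean := tendsto_densityMean hJ hcoex
  have habs := tendsto_map_abs_sub heq.1 (densityMean_nonneg J h) (densityMean_one J h) hconc
  obtain ⟨C, hC0, hstein⟩ := abs_mul_densityMean_drift_sub_le hJ h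
  have hdrift := heq.hasDerivAt_drift
  have hdrift0 := heq.drift_eq_zero
  have h1 := sub_pos.2 heq.lt_one
  have hM := heq.1
  generalize limitDensity J h = M at *
  obtain ⟨B, hB⟩ := isCompact_Icc.exists_bound_of_continuousOn
    (continuous_drift J h).continuousOn (s := Set.Icc (0 : ℝ) 1)
  -- Stein's identity for `φ m = m - M` ...
  have hb : Tendsto (fun N : ℕ => N * densityMean J h N (fun m => (m - M) * drift J h m)) atTop
      (𝓝 (2 * (1 - M))) := by
    have h2 : Tendsto (fun N : ℕ => N * densityMean J h N (fun m => (m - M) * drift J h m)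
        - 2 * (1 - densityMean J h N (fun m => m))) atTop (𝓝 0) := by
      have habs' := habs.const_mul C
      rw [mul_zero] at habs'
      refine squeeze_zero_norm' ?_ habs'
      filter_upwards [eventually_ne_atTop 0] with N hN
      have hN' : (N : ℝ) ≠ 0 := Nat.cast_ne_zero.2 hN
      have h3 := hstein N hN (fun m => m - M)
      have h4 : (fun m : ℝ => N * (m + 2 / N - M - (m - M)) * (1 - m))
          = (2 : ℝ) • ((fun _ => (1 : ℝ)) - fun m => m) := by
        ext m
        simp only [Pi.smul_apply, Pi.sub_apply, smul_eq_mul]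
        field_simp
        ring
      rw [h4, map_smul, map_sub, densityMean_one, smul_eq_mul] at h3
      exact h3
    have h5 := h2.add ((hmean.const_sub 1).const_mul 2)
    rw [zero_add] at h5
    exact h5.congr fun N => by ring
  -- ... and for `φ = 1`.
  have hF0 : Tendsto (fun N : ℕ => N * densityMean J h N (drift J h) ^ 2) atTop (𝓝 0) := by
    have h2 := tendsto_const_div_atTop_nhds_zero_nat (C ^ 2)
    refine squeeze_zero' (Eventually.of_forall fun N => by positivity) ?_ h2
    filter_upwards [eventually_ne_atTop 0] with N hN
    have hN' : (0 : ℝ) < N := by positivity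
    have h3 := hstein N hN (fun _ => 1)
    simp only [one_mul, sub_self, mul_zero, zero_mul, abs_one, densityMean_one, mul_one] at h3
    have h4 : densityMean J h N (fun _ => 0) = 0 := map_zero _
    rw [h4, sub_zero] at h3
    have h5 := sq_le_sq' (by linarith [(abs_le.1 h3).1]) (abs_le.1 h3).2
    rw [le_div_iff₀ hN']
    calc N * densityMean J h N (drift J h) ^ 2 * N = (N * densityMean J h N (drift J h)) ^ 2 := by
          ring
      _ ≤ C ^ 2 := h5
  have hκ : 0 < 2 * (1 - M) * (1 / M + 1 / (2 * (1 - M)) - 2 * J) :=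
    mul_pos (by linarith) (by linarith)
  have key := tendsto_variance hM (densityMean_nonneg J h) (densityMean_one J h) hconc hκ hdrift
    hdrift0 hB hb hF0
  rw [div_mul_cancel_left₀ (by positivity)] at key
  refine key.congr' ?_
  filter_upwards [eventually_ne_atTop 0] with N hN
  unfold susceptibility meanDensity
  rw [gibbsMean_eq_densityMean hN J h (fun m => m ^ 2),
    gibbsMean_eq_densityMean hN J h (fun m => m)]

end MonomerDimer

end

/-- Convergence of the finite-size susceptibility of the imitative monomer-dimer model on the
complete graph, off the coexistence curve and its end point. -/
theorem mainTheorem1 (J h : ℝ) (hJ : 0 ≤ J)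
    (hcoex : (J, h) ∉ MonomerDimer.coexistenceCurve)
    (hcrit : (J, h) ≠ MonomerDimer.criticalPoint) :
    -- `m(J,h)` is the equilibrium value, and it is the limit of the finite-size densities
    MonomerDimer.IsEquilibrium J h (MonomerDimer.limitDensity J h) ∧
    Tendsto (fun N : ℕ => MonomerDimer.meanDensity N J h) atTop
      (𝓝 (MonomerDimer.limitDensity J h)) ∧
    -- both `h`-derivatives exist
    (∀ N : ℕ, 1 ≤ N → HasDerivAt (fun h' : ℝ => MonomerDimer.meanDensity N J h')
      (MonomerDimer.susceptibility N J h) h) ∧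
    DifferentiableAt ℝ (fun h' : ℝ => MonomerDimer.limitDensity J h') h ∧
    -- the susceptibilities converge
    Tendsto (fun N : ℕ => deriv (fun h' : ℝ => MonomerDimer.meanDensity N J h') h) atTop
      (𝓝 (deriv (fun h' : ℝ => MonomerDimer.limitDensity J h') h)) ∧
    -- the common value
    0 < 1 - 2 * J * deriv MonomerDimer.g ((2 * MonomerDimer.limitDensity J h - 1) * J + h) ∧
    deriv (fun h' : ℝ => MonomerDimer.limitDensity J h') h =
      deriv MonomerDimer.g ((2 * MonomerDimer.limitDensity J h - 1) * J + h) /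
        (1 - 2 * J * deriv MonomerDimer.g ((2 * MonomerDimer.limitDensity J h - 1) * J + h)) := by
  have heq := MonomerDimer.isEquilibrium_limitDensity hJ h
  have hd := MonomerDimer.hasDerivAt_limitDensity hJ hcoex hcrit
  have hneg := MonomerDimer.deriv2_rate_neg hJ hcoex hcrit
  have hs : 0 < 1 / MonomerDimer.limitDensity J h
      + 1 / (2 * (1 - MonomerDimer.limitDensity J h)) := by
    have := heq.pos
    have := sub_pos.2 heq.lt_one
    positivity
  refine ⟨heq, ?_, fun N hN => MonomerDimer.hasDerivAt_meanDensity (by omega) J h,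
    hd.differentiableAt, ?_, ?_, ?_⟩
  · refine (MonomerDimer.tendsto_densityMean hJ hcoex).congr' ?_
    filter_upwards [eventually_ne_atTop 0] with N hN
    exact (MonomerDimer.gibbsMean_eq_densityMean hN J h (fun m => m)).symm
  · rw [hd.deriv]
    refine (MonomerDimer.tendsto_susceptibility hJ hcoex hcrit).congr' ?_
    filter_upwards [eventually_ne_atTop 0] with N hN
    exact (MonomerDimer.hasDerivAt_meanDensity hN J h).deriv.symm
  · rw [MonomerDimer.deriv_g_limitDensity hJ h, sub_pos, ← div_eq_mul_inv, div_lt_one hs]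
    linarith
  · rw [hd.deriv, MonomerDimer.deriv_g_limitDensity hJ h]
    generalize 1 / MonomerDimer.limitDensity J h
      + 1 / (2 * (1 - MonomerDimer.limitDensity J h)) = s at *
    have : s - 2 * J ≠ 0 := by linarith
    have : 1 - 2 * J * s⁻¹ ≠ 0 := by
      rw [← div_eq_mul_inv, one_sub_div hs.ne']
      exact div_ne_zero this hs.ne'
    field_simp
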